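/- Let $(W,S)$ be an irreducible Coxeter system with $S=\{s_1,\dots,s_n\}$ finite and $W$ infinite, and let $w=s_1s_2\cdots s_n$. For $T\subseteq S$ let $W_T=\langle T\rangle$ be the standard parabolic subgroup, let $R_T$ be the set of all $W_T$-conjugates of elements of $T$, let $\ell_T$ be the word length on $W_T$ with respect to $R_T$, let $w_T$ be the product of the elements of $T$ in the order induced by $s_1,\dots,s_n$, and let $$[1,w_T]=\{x\in W_T : \ell_T(x)+\ell_T(x^{-1}w_T)=\ell_T(w_T)\}.$$ The interval complex $K_{W_T}$ is the $\Delta$-complex with one $d$-simplex $[x_1|\cdots|x_d]$ for each $d$-tuple of elements of $[1,w_T]\setminus\{1\}$ such that $\ell_T(x_1)+\dots+\ell_T(x_d)=\ell_T(x_1\cdots x_d)$ and $x_1\cdots x_d\in[1,w_T]$ (for $d=0$, one vertex $[\,]$). Its faces are $\partial_0[x_1|\cdots|x_d]=[x_2|\cdots|x_d]$, $\partial_i[x_1|\cdots|x_d]=[x_1|\cdots|x_ix_{i+1}|\cdots|x_d]$ for $0<i<d$, and $\partial_d[x_1|\cdots|x_d]=[x_1|\cdots|x_{d-1}]$. Write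 $K_W=K_{W_S}$. For $U\subseteq T$ the complex $K_{W_U}$ is naturally a subcomplex of $K_{W_T}$. Define $$X'_W=\bigcup_{T\subseteq S,\ W_T\text{ finite}}K_{W_T}\subseteq K_W,\qquad X''_{W_T}=\bigcup_{U\subsetneq T}K_{W_U}\subseteq K_{W_T}.$$ For a subcomplex $Y$ of a $\Delta$-complex $X$ write $X\searrow Y$ if the geometric realization of $X$ deformation retracts onto that of $Y$, i.e. there is a homotopy, constant on $Y$, from the identity of $X$ to a map with image in $Y$. Proposition. Suppose that $K_{W_T}\searrow X''_{W_T}$ for every $T\subseteq S$ such that $W_T$ is infinite. Then $K_W\searrow X'_W$. -/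

import Mathlib

open scoped BigOperators

/-! ### Δ-complexes, their geometric realizations and deformation retractions -/

/-- A Δ-complex, given by its simplices and its face maps (subject to the usual relations). -/
structure DeltaComplex where
  /-- The set of `n`-dimensional simplices. -/
  Simplex : ℕ → Type*
  /-- `face i σ` is the `i`-th codimension-one face of `σ`. -/
  face : ∀ {n : ℕ}, Fin (n + 2) → Simplex (n + 1) → Simplex n
  face_face : ∀ {n : ℕ} (i j : Fin (n + 2)), i ≤ j → ∀ σ : Simplex (n + 2),
    face i (face j.succ σ) = face j (face i.castSucc σ)

namespace DeltaComplex

/-- The disjoint union of one closed standard simplex for each simplex of `K`. -/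
abbrev Cells (K : DeltaComplex) : Type _ :=
  Σ p : (Σ n : ℕ, K.Simplex n), stdSimplex ℝ (Fin (p.1 + 1))

/-- The gluing relation: the `i`-th face of the standard simplex attached to `σ` is identified
with the standard simplex attached to the `i`-th face of `σ`, preserving the order of vertices. -/
inductive Glue (K : DeltaComplex) : K.Cells → K.Cells → Prop
  | face {n : ℕ} (i : Fin (n + 2)) (σ : K.Simplex (n + 1)) (t : stdSimplex ℝ (Fin (n + 1))) :
      Glue K ⟨⟨n, K.face i σ⟩, t⟩ ⟨⟨n + 1, σ⟩, stdSimplex.map i.succAbove t⟩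

/-- The geometric realization of `K`, with the quotient topology. -/
def Realization (K : DeltaComplex) : Type _ := Quot K.Glue

instance (K : DeltaComplex) : TopologicalSpace K.Realization :=
  inferInstanceAs (TopologicalSpace (Quot K.Glue))

/-- The point of the realization with coordinates `t` in the closed simplex `σ`. -/
def point (K : DeltaComplex) {n : ℕ} (σ : K.Simplex n) (t : stdSimplex ℝ (Fin (n + 1))) :
    K.Realization := Quot.mk K.Glue ⟨⟨n, σ⟩, t⟩

/-- A subcomplex: a family of simplices that contains the faces of its members. -/
structure Subcomplex (K : DeltaComplex) where
  carrier : ∀ n : ℕ, Set (K.Simplex n)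
  face_mem : ∀ {n : ℕ} (i : Fin (n + 2)) (σ : K.Simplex (n + 1)),
    σ ∈ carrier (n + 1) → K.face i σ ∈ carrier n

/-- The subspace of the realization that is the union of the simplices of a subcomplex. -/
def Subcomplex.space {K : DeltaComplex} (L : K.Subcomplex) : Set K.Realization :=
  {p | ∃ (n : ℕ) (σ : K.Simplex n) (t : stdSimplex ℝ (Fin (n + 1))),
    σ ∈ L.carrier n ∧ p = K.point σ t}

end DeltaComplex

/-- `X` deformation retracts onto `A`: there is a homotopy, constant on `A`, from the identity
of `X` to a map with values in `A`. -/
def DeformationRetractsOnto (X : Type*) [TopologicalSpace X] (A : Set X) : Prop :=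
  ∃ r : C(X, X), (∀ x, r x ∈ A) ∧ (ContinuousMap.id X).HomotopicRel r A

/-- `K ↘ L` for a Δ-complex `K` and a subcomplex `L`. -/
def DeltaComplex.RetractsTo (K : DeltaComplex) (L : K.Subcomplex) : Prop :=
  DeformationRetractsOnto K.Realization L.space

/-! ### Intervals in Cayley graphs and interval complexes -/

namespace IntervalGroup

variable {G : Type*} [Group G]

/-- The word length of `x` with respect to `R`. It is used only when `R` is closed under inverses
and `x` belongs to the subgroup generated by `R`. -/
noncomputable def length (R : Set G) (x : G) : ℕ :=
  sInf {k | ∃ L : List G, (∀ r ∈ L, r ∈ R) ∧ L.length = k ∧ L.prod = x}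

/-- The interval `[1, g]` in the right Cayley graph, with generating set `R`, of the subgroup
generated by `R`. -/
def interval (R : Set G) (g : G) : Set G :=
  {x | x ∈ Subgroup.closure R ∧ length R x + length R (x⁻¹ * g) = length R g}

/-- `[x₁|⋯|x_d]` is a simplex of the interval complex of `[1, g]`. -/
structure IsSimplex (R : Set G) (g : G) {d : ℕ} (x : Fin d → G) : Prop where
  mem : ∀ k, x k ∈ interval R g
  ne_one : ∀ k, x k ≠ 1
  sum_length : ∑ k, length R (x k) = length R (List.ofFn x).prod
  prod_mem : (List.ofFn x).prod ∈ interval R g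

/-- The faces of `[x₁|⋯|x_d]`: `∂₀` drops `x₁`, `∂_i` multiplies `x_i` and `x_{i+1}` for
`0 < i < d`, and `∂_d` drops `x_d` (by definition of `Fin.contractNth` at its last index). -/
def face {d : ℕ} (i : Fin (d + 2)) (x : Fin (d + 1) → G) : Fin d → G :=
  Fin.cases (motive := fun _ => Fin d → G) (Fin.tail x)
    (fun j => Fin.contractNth j (· * ·) x) i

theorem exists_list {R : Set G} (hinv : ∀ r ∈ R, r⁻¹ ∈ R) {x : G}
    (hx : x ∈ Subgroup.closure R) : ∃ L : List G, (∀ r ∈ L, r ∈ R) ∧ L.prod = x := by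
  induction hx using Subgroup.closure_induction with
  | mem x hx => exact ⟨[x], by simpa using hx, by simp⟩
  | one => exact ⟨[], by simp, by simp⟩
  | mul x y _ _ hx hy =>
    obtain ⟨L, hL, rfl⟩ := hx
    obtain ⟨L', hL', rfl⟩ := hy
    refine ⟨L ++ L', ?_, by simp⟩
    intro r hr
    rcases List.mem_append.1 hr with h | h
    · exact hL r h
    · exact hL' r h
  | inv x _ hx =>
    obtain ⟨L, hL, rfl⟩ := hx
    refine ⟨(L.map fun a => a⁻¹).reverse, ?_, by rw [List.prod_inv_reverse]⟩
    intro r hr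
    simp only [List.mem_reverse, List.mem_map] at hr
    obtain ⟨a, ha, rfl⟩ := hr
    exact hinv a (hL a ha)

theorem length_le {R : Set G} {L : List G} (hL : ∀ r ∈ L, r ∈ R) :
    length R L.prod ≤ L.length :=
  Nat.sInf_le ⟨L, hL, rfl, rfl⟩

theorem exists_length_eq {R : Set G} (hinv : ∀ r ∈ R, r⁻¹ ∈ R) {x : G}
    (hx : x ∈ Subgroup.closure R) :
    ∃ L : List G, (∀ r ∈ L, r ∈ R) ∧ L.length = length R x ∧ L.prod = x := by
  obtain ⟨L, hL, hLx⟩ := exists_list hinv hx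
  exact Nat.sInf_mem (s := {k | ∃ L : List G, (∀ r ∈ L, r ∈ R) ∧ L.length = k ∧ L.prod = x})
    ⟨_, L, hL, rfl, hLx⟩

theorem length_one (R : Set G) : length R 1 = 0 := by
  have := length_le (R := R) (L := []) (by simp)
  simpa using this

theorem length_mul_le {R : Set G} (hinv : ∀ r ∈ R, r⁻¹ ∈ R) {x y : G}
    (hx : x ∈ Subgroup.closure R) (hy : y ∈ Subgroup.closure R) :
    length R (x * y) ≤ length R x + length R y := by
  obtain ⟨L, hL, hl, rfl⟩ := exists_length_eq hinv hx
  obtain ⟨L', hL', hl', rfl⟩ := exists_length_eq hinv hy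
  rw [← hl, ← hl', ← List.length_append, ← List.prod_append]
  apply length_le
  intro r hr
  rcases List.mem_append.1 hr with h | h
  · exact hL r h
  · exact hL' r h

theorem eq_one_of_length {R : Set G} (hinv : ∀ r ∈ R, r⁻¹ ∈ R) {x : G}
    (hx : x ∈ Subgroup.closure R) (h : length R x = 0) : x = 1 := by
  obtain ⟨L, _, hl, rfl⟩ := exists_length_eq hinv hx
  rw [h, List.length_eq_zero_iff] at hl
  simp [hl]

theorem conj_mem_of_mem_closure {R : Set G} (hinv : ∀ r ∈ R, r⁻¹ ∈ R)
    (hconj : ∀ r ∈ R, ∀ t ∈ R, r * t * r⁻¹ ∈ R) {y : G} (hy : y ∈ Subgroup.closure R) :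
    ∀ t ∈ R, y * t * y⁻¹ ∈ R := by
  obtain ⟨L, hL, rfl⟩ := exists_list hinv hy
  clear hy
  induction L with
  | nil => simp
  | cons a L ih =>
    intro t ht
    have h1 := ih (fun r hr => hL r (List.mem_cons_of_mem _ hr)) t ht
    have h2 := hconj a (hL a List.mem_cons_self) _ h1
    simpa [mul_assoc] using h2

theorem length_conj_le {R : Set G} (hinv : ∀ r ∈ R, r⁻¹ ∈ R)
    (hconj : ∀ r ∈ R, ∀ t ∈ R, r * t * r⁻¹ ∈ R) {x y : G}
    (hx : x ∈ Subgroup.closure R) (hy : y ∈ Subgroup.closure R) :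
    length R (y * x * y⁻¹) ≤ length R x := by
  obtain ⟨L, hL, hl, rfl⟩ := exists_length_eq hinv hx
  have h : y * L.prod * y⁻¹ = (L.map (MulAut.conj y)).prod := by
    rw [← map_list_prod, MulAut.conj_apply]
  rw [h, ← hl, ← List.length_map (f := MulAut.conj y)]
  apply length_le
  intro r hr
  obtain ⟨a, ha, rfl⟩ := List.mem_map.1 hr
  exact conj_mem_of_mem_closure hinv hconj hy a (hL a ha)

/-- A factor of a reduced factorization of an element of `[1, g]` lies in `[1, g]`. -/
theorem factor_mem {R : Set G} (hinv : ∀ r ∈ R, r⁻¹ ∈ R)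
    (hconj : ∀ r ∈ R, ∀ t ∈ R, r * t * r⁻¹ ∈ R) {g : G} (hg : g ∈ Subgroup.closure R)
    {a q b : G} (ha : a ∈ Subgroup.closure R) (hq : q ∈ Subgroup.closure R)
    (hb : b ∈ Subgroup.closure R)
    (hsum : length R a + length R q + length R b = length R (a * q * b))
    (hp : a * q * b ∈ interval R g) : q ∈ interval R g := by
  refine ⟨hq, ?_⟩
  have hc : (a * q * b)⁻¹ * g ∈ Subgroup.closure R := mul_mem (inv_mem hp.1) hg
  have e : q⁻¹ * g = q⁻¹ * a * q⁻¹⁻¹ * (b * ((a * q * b)⁻¹ * g)) := by group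
  have h1 : length R (q⁻¹ * g) ≤
      length R (q⁻¹ * a * q⁻¹⁻¹) + length R (b * ((a * q * b)⁻¹ * g)) := by
    rw [e]
    exact length_mul_le hinv (mul_mem (mul_mem (inv_mem hq) ha) (inv_mem (inv_mem hq)))
      (mul_mem hb hc)
  have h2 := length_conj_le hinv hconj ha (inv_mem hq)
  have h3 := length_mul_le hinv hb hc
  have h4 := length_mul_le hinv hq (mul_mem (inv_mem hq) hg)
  rw [mul_inv_cancel_left] at h4
  have h5 := hp.2
  omega

theorem partialProd_face {d : ℕ} (i : Fin (d + 2)) (x : Fin (d + 1) → G) (k : Fin (d + 1)) :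
    Fin.partialProd (face i x) k =
      (Fin.partialProd x (i.succAbove 0))⁻¹ * Fin.partialProd x (i.succAbove k) := by
  refine Fin.cases ?_ (fun j => ?_) i
  · have h0 := Fin.partialProd_succ' x 0
    have hk := Fin.partialProd_succ' x k
    simp only [Fin.partialProd_zero, mul_one] at h0
    simp only [face, Fin.cases_zero, Fin.succAbove_zero]
    rw [h0, hk, inv_mul_cancel_left]
  · simp only [face, Fin.cases_succ]
    rw [Fin.partialProd_contractNth]
    simp

theorem eq_of_partialProd {d : ℕ} {x y : Fin d → G}
    (h : ∀ k, Fin.partialProd x k = Fin.partialProd y k) : x = y := by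
  funext k
  rw [← Fin.partialProd_right_inv x k, ← Fin.partialProd_right_inv y k, h, h]

theorem face_face {d : ℕ} (i j : Fin (d + 2)) (h : i ≤ j) (x : Fin (d + 2) → G) :
    face i (face j.succ x) = face j (face i.castSucc x) := by
  apply eq_of_partialProd
  intro k
  have key : ∀ k : Fin (d + 1),
      j.succ.succAbove (i.succAbove k) = i.castSucc.succAbove (j.succAbove k) := by
    intro k
    have := congrArg (fun f => f.toOrderHom k) (SimplexCategory.δ_comp_δ h)
    simpa [SimplexCategory.δ] using this
  simp only [partialProd_face, key]
  group

theorem prod_ofFn_eq {d : ℕ} (x : Fin d → G) :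
    (List.ofFn x).prod = Fin.partialProd x (Fin.last d) := by
  simp [Fin.partialProd, List.take_of_length_le]

/-- The chain of partial products of a simplex is a chain for the order given by lengths. -/
structure IsChain (R : Set G) (g : G) {d : ℕ} (P : Fin (d + 1) → G) : Prop where
  mem : ∀ i j, (P i)⁻¹ * P j ∈ Subgroup.closure R
  add : ∀ i j k, i ≤ j → j ≤ k →
    length R ((P i)⁻¹ * P j) + length R ((P j)⁻¹ * P k) = length R ((P i)⁻¹ * P k)
  ne : ∀ i j, i < j → P i ≠ P j
  last : (P 0)⁻¹ * P (Fin.last d) ∈ interval R g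

theorem IsSimplex.isChain {R : Set G} (hinv : ∀ r ∈ R, r⁻¹ ∈ R) {g : G} {d : ℕ} {x : Fin d → G}
    (hx : IsSimplex R g x) : IsChain R g (Fin.partialProd x) := by
  set P := Fin.partialProd x with hP
  have hmem : ∀ i, P i ∈ Subgroup.closure R := by
    intro i
    induction i using Fin.induction with
    | zero => simp [hP, one_mem]
    | succ k ih => rw [hP, Fin.partialProd_succ]; exact mul_mem ih (hx.mem k).1
  have hmem2 : ∀ i j, (P i)⁻¹ * P j ∈ Subgroup.closure R :=
    fun i j => mul_mem (inv_mem (hmem i)) (hmem j)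
  let F : Fin (d + 1) → ℕ := Fin.partialSum fun k => length R (x k)
  have hF : ∀ k : Fin d, F k.succ = F k.castSucc + length R (x k) :=
    fun k => Fin.partialSum_succ _ k
  have hF0 : F 0 = 0 := Fin.partialSum_zero _
  have hFl : F (Fin.last d) = length R (P (Fin.last d)) := by
    rw [hP, ← prod_ofFn_eq, ← hx.sum_length, ← List.sum_ofFn]
    simp [F, Fin.partialSum, List.take_of_length_le]
  have hle : ∀ i j, i ≤ j → length R ((P i)⁻¹ * P j) + F i ≤ F j := by
    intro i j
    induction j using Fin.induction with
    | zero =>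
      intro h
      have : i = 0 := Fin.le_zero_iff.1 h
      subst this
      simp [length_one]
    | succ k ih =>
      intro h
      rcases h.lt_or_eq with h' | rfl
      · have h1 := ih (Fin.le_castSucc_iff.2 h')
        have h2 : (P i)⁻¹ * P k.succ = (P i)⁻¹ * P k.castSucc * x k := by
          rw [hP, Fin.partialProd_succ, mul_assoc]
        have h3 := length_mul_le hinv (hmem2 i k.castSucc) (hx.mem k).1
        rw [h2, hF]
        omega
      · simp [length_one]
  have heq : ∀ i j, i ≤ j → length R ((P i)⁻¹ * P j) + F i = F j := by
    intro i j hij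
    have h1 := hle 0 i (Fin.zero_le i)
    have h2 := hle i j hij
    have h3 := hle j (Fin.last d) (Fin.le_last j)
    have e1 : P (Fin.last d) =
        (P 0)⁻¹ * P i * ((P i)⁻¹ * P j * ((P j)⁻¹ * P (Fin.last d))) := by
      simp [hP, mul_assoc]
    have h4 := length_mul_le hinv (hmem2 0 i)
      (mul_mem (hmem2 i j) (hmem2 j (Fin.last d)))
    have h5 := length_mul_le hinv (hmem2 i j) (hmem2 j (Fin.last d))
    rw [← e1, ← hFl] at h4
    omega
  have hlt : ∀ i j, i < j → F i < F j := by
    apply Fin.strictMono_iff_lt_succ.2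
    intro k
    have h1 : length R (x k) ≠ 0 :=
      fun h => hx.ne_one k (eq_one_of_length hinv (hx.mem k).1 h)
    rw [hF]
    omega
  refine ⟨hmem2, ?_, ?_, ?_⟩
  · intro i j k hij hjk
    have h1 := heq i j hij
    have h2 := heq j k hjk
    have h3 := heq i k (hij.trans hjk)
    omega
  · intro i j hij h
    have h1 := heq i j hij.le
    have h2 := hlt i j hij
    rw [h, inv_mul_cancel, length_one] at h1
    omega
  · have h1 := hx.prod_mem
    rw [prod_ofFn_eq] at h1
    simpa [hP] using h1

theorem IsChain.isSimplex {R : Set G} (hinv : ∀ r ∈ R, r⁻¹ ∈ R)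
    (hconj : ∀ r ∈ R, ∀ t ∈ R, r * t * r⁻¹ ∈ R) {g : G} (hg : g ∈ Subgroup.closure R)
    {d : ℕ} {x : Fin d → G} (hP : IsChain R g (Fin.partialProd x)) : IsSimplex R g x := by
  have hx : ∀ k, x k = (Fin.partialProd x k.castSucc)⁻¹ * Fin.partialProd x k.succ :=
    fun k => (Fin.partialProd_right_inv x k).symm
  have hl := hP.last
  rw [Fin.partialProd_zero, inv_one, one_mul] at hl
  refine ⟨?_, ?_, ?_, ?_⟩
  · intro k
    have h1 := hP.add 0 k.castSucc k.succ (Fin.zero_le _) (Fin.castSucc_lt_succ).le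
    have h2 := hP.add 0 k.succ (Fin.last d) (Fin.zero_le _) (Fin.le_last _)
    have e : (Fin.partialProd x 0)⁻¹ * Fin.partialProd x k.castSucc * x k *
        ((Fin.partialProd x k.succ)⁻¹ * Fin.partialProd x (Fin.last d)) =
        (Fin.partialProd x 0)⁻¹ * Fin.partialProd x (Fin.last d) := by
      rw [hx k]; group
    refine factor_mem hinv hconj hg (hP.mem 0 k.castSucc) (by rw [hx k]; exact hP.mem _ _)
      (hP.mem k.succ (Fin.last d)) ?_ ?_
    · rw [e, ← h2, ← h1, ← hx k]
    · rw [e]; exact hP.last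
  · intro k h
    have h1 := hP.ne k.castSucc k.succ Fin.castSucc_lt_succ
    rw [Fin.partialProd_succ, h, mul_one] at h1
    exact h1 rfl
  · have h : ∀ j : Fin (d + 1), Fin.partialSum (fun k => length R (x k)) j =
        length R (Fin.partialProd x j) := by
      intro j
      induction j using Fin.induction with
      | zero => simp [length_one]
      | succ k ih =>
        have h1 := hP.add 0 k.castSucc k.succ (Fin.zero_le _) (Fin.castSucc_lt_succ).le
        rw [← hx k] at h1
        simp only [Fin.partialProd_zero, inv_one, one_mul] at h1
        rw [Fin.partialSum_succ, ih, h1]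
    rw [prod_ofFn_eq, ← h, ← List.sum_ofFn]
    simp [Fin.partialSum, List.take_of_length_le]
  · rw [prod_ofFn_eq]; exact hl

theorem IsSimplex.face {R : Set G} (hinv : ∀ r ∈ R, r⁻¹ ∈ R)
    (hconj : ∀ r ∈ R, ∀ t ∈ R, r * t * r⁻¹ ∈ R) {g : G} (hg : g ∈ Subgroup.closure R)
    {d : ℕ} (i : Fin (d + 2)) {x : Fin (d + 1) → G} (hx : IsSimplex R g x) :
    IsSimplex R g (IntervalGroup.face i x) := by
  have h := hx.isChain hinv
  apply IsChain.isSimplex hinv hconj hg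
  have e : ∀ a b, (Fin.partialProd (IntervalGroup.face i x) a)⁻¹ *
      Fin.partialProd (IntervalGroup.face i x) b =
      (Fin.partialProd x (i.succAbove a))⁻¹ * Fin.partialProd x (i.succAbove b) := by
    intro a b
    simp only [partialProd_face]
    group
  have hmono := (Fin.strictMono_succAbove i)
  refine ⟨?_, ?_, ?_, ?_⟩
  · intro a b
    rw [e]; exact h.mem _ _
  · intro a b c hab hbc
    simp only [e]
    exact h.add _ _ _ (hmono.monotone hab) (hmono.monotone hbc)
  · intro a b hab he
    rw [partialProd_face, partialProd_face, mul_right_inj] at he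
    exact h.ne _ _ (hmono hab) he
  · rw [e]
    set a := i.succAbove 0
    set b := i.succAbove (Fin.last d)
    have hab : a ≤ b := hmono.monotone (Fin.zero_le _)
    have h1 := h.add 0 a b (Fin.zero_le _) hab
    have h2 := h.add 0 b (Fin.last _) (Fin.zero_le _) (Fin.le_last _)
    have e' : (Fin.partialProd x 0)⁻¹ * Fin.partialProd x a *
        ((Fin.partialProd x a)⁻¹ * Fin.partialProd x b) *
        ((Fin.partialProd x b)⁻¹ * Fin.partialProd x (Fin.last _)) =
        (Fin.partialProd x 0)⁻¹ * Fin.partialProd x (Fin.last _) := by group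
    refine factor_mem hinv hconj hg (h.mem 0 a) (h.mem a b) (h.mem b (Fin.last _)) ?_ ?_
    · rw [e', ← h2, ← h1]
    · rw [e']; exact h.last

/-- The interval complex of `[1, g]`, for a set `R` of generators that is closed under inverses
and conjugation. -/
def intervalComplex (R : Set G) (hinv : ∀ r ∈ R, r⁻¹ ∈ R)
    (hconj : ∀ r ∈ R, ∀ t ∈ R, r * t * r⁻¹ ∈ R) (g : G) (hg : g ∈ Subgroup.closure R) :
    DeltaComplex where
  Simplex d := {x : Fin d → G // IsSimplex R g x}
  face i x := ⟨face i x.1, x.2.face hinv hconj hg i⟩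
  face_face i j h x := Subtype.ext (face_face i j h x.1)

end IntervalGroup

/-! ### Coxeter systems: parabolic subgroups, and the complexes `K`, `X'` and `X''` -/

/-- The Coxeter diagram: two distinct vertices are joined if `m(s, t) ≥ 3` (in Mathlib's
convention, the entry `0` of a Coxeter matrix stands for `∞`). -/
def CoxeterMatrix.diagram {B : Type*} (M : CoxeterMatrix B) : SimpleGraph B where
  Adj i j := i ≠ j ∧ M i j ≠ 2
  symm := ⟨fun i j h => ⟨h.1.symm, by rw [M.symmetric]; exact h.2⟩⟩
  loopless := ⟨fun _ h => h.1 rfl⟩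

/-- A Coxeter system is irreducible if its Coxeter diagram is connected. -/
def CoxeterMatrix.IsIrreducible {B : Type*} (M : CoxeterMatrix B) : Prop := M.diagram.Connected

namespace CoxeterSystem

open IntervalGroup

variable {n : ℕ} {M : CoxeterMatrix (Fin n)} {W : Type*} [Group W] (cs : CoxeterSystem M W)

/-- The standard parabolic subgroup `W_T`. -/
def parabolic (T : Finset (Fin n)) : Subgroup W := Subgroup.closure (cs.simple '' T)

/-- The reflections of the Coxeter system `(W_T, T)`: the `W_T`-conjugates of elements of `T`. -/
def parabolicReflections (T : Finset (Fin n)) : Set W :=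
  {r | ∃ u ∈ cs.parabolic T, ∃ i ∈ T, r = u * cs.simple i * u⁻¹}

/-- The Coxeter element `w_T`: the product of the elements of `T` in increasing order. -/
def coxeterElement (T : Finset (Fin n)) : W := cs.wordProd T.sort

theorem simple_mem_parabolicReflections {T : Finset (Fin n)} {i : Fin n} (hi : i ∈ T) :
    cs.simple i ∈ cs.parabolicReflections T := ⟨1, one_mem _, i, hi, by simp⟩

theorem inv_mem_parabolicReflections (T : Finset (Fin n)) :
    ∀ r ∈ cs.parabolicReflections T, r⁻¹ ∈ cs.parabolicReflections T := by
  rintro _ ⟨u, hu, i, hi, rfl⟩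
  exact ⟨u, hu, i, hi, by simp [mul_assoc]⟩

theorem parabolicReflections_subset (T : Finset (Fin n)) :
    cs.parabolicReflections T ⊆ cs.parabolic T := by
  rintro _ ⟨u, hu, i, hi, rfl⟩
  exact mul_mem (mul_mem hu (Subgroup.subset_closure ⟨i, hi, rfl⟩)) (inv_mem hu)

theorem conj_mem_parabolicReflections (T : Finset (Fin n)) :
    ∀ r ∈ cs.parabolicReflections T, ∀ t ∈ cs.parabolicReflections T,
      r * t * r⁻¹ ∈ cs.parabolicReflections T := by
  rintro r hr _ ⟨u, hu, i, hi, rfl⟩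
  exact ⟨r * u, mul_mem (cs.parabolicReflections_subset T hr) hu, i, hi, by simp [mul_assoc]⟩

theorem coxeterElement_mem (T : Finset (Fin n)) :
    cs.coxeterElement T ∈ Subgroup.closure (cs.parabolicReflections T) := by
  unfold coxeterElement wordProd
  apply list_prod_mem
  intro r hr
  obtain ⟨i, hi, rfl⟩ := List.mem_map.1 hr
  exact Subgroup.subset_closure (cs.simple_mem_parabolicReflections ((Finset.mem_sort _).1 hi))

/-- The interval complex `K_{W_T}` of the Coxeter system `(W_T, T)` with Coxeter element `w_T`;
for `T = S` it is `K_W`. Lengths are taken in `W_T` with respect to the reflections of `W_T`. -/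
def K (T : Finset (Fin n)) : DeltaComplex :=
  intervalComplex (cs.parabolicReflections T) (cs.inv_mem_parabolicReflections T)
    (cs.conj_mem_parabolicReflections T) (cs.coxeterElement T) (cs.coxeterElement_mem T)

/-- The tuple `[x₁|⋯|x_d]` of elements of `W` is a simplex of `K_{W_T}`. -/
def IsSimplexOfK (T : Finset (Fin n)) {d : ℕ} (x : Fin d → W) : Prop :=
  IsSimplex (cs.parabolicReflections T) (cs.coxeterElement T) x

/-- The union, as a subcomplex of `K_{W_T}`, of the complexes `K_{W_U}` with `U ⊆ T` satisfying
the condition `C`. -/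
def unionOfK (T : Finset (Fin n)) (C : Finset (Fin n) → Prop) : (cs.K T).Subcomplex where
  carrier _ := {σ | ∃ U, U ⊆ T ∧ C U ∧ cs.IsSimplexOfK U σ.1}
  face_mem := by
    rintro d i σ ⟨U, hU, hC, hσ⟩
    exact ⟨U, hU, hC, hσ.face (cs.inv_mem_parabolicReflections U)
      (cs.conj_mem_parabolicReflections U) (cs.coxeterElement_mem U) i⟩

/-- `X'_{W_T}`: the union of the `K_{W_U}` with `U ⊆ T` and `W_U` finite. -/
def X' (T : Finset (Fin n)) : (cs.K T).Subcomplex :=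
  cs.unionOfK T fun U => Finite (cs.parabolic U)

/-- `X''_{W_T}`: the union of the `K_{W_U}` with `U` a proper subset of `T`. -/
def X'' (T : Finset (Fin n)) : (cs.K T).Subcomplex :=
  cs.unionOfK T fun U => U ≠ T

end CoxeterSystem

/-! Adjoin to X'_W the complexes K_{W_T} with W_T infinite, one at a time and by increasing size of
T. When T is adjoined, its proper subsets are already present and its supersets are not, so K_{W_T}
meets the union built so far exactly in X''_{W_T}. The assumed retraction of K_{W_T}, extended by
the identity, deforms the new union into the old one. Concatenating these finitely many
deformations, from T = S downwards, proves the theorem.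

The combinatorial input is K_{W_T} ∩ K_{W_U} = K_{W_{T∩U}} inside K_W (`IsSimplexOfK.inter`). It
rests on three facts: ℓ_T is the restriction of ℓ_S (`length_parabolicReflections`), [1,w_U] =
[1,w_T] ∩ W_U for U ⊆ T (`mem_interval_of_subset`, `mem_interval_of_mem_parabolic`), and W_T ∩ W_U =
W_{T∩U} (`parabolic_inf`). Reflection lengths are controlled by Dyer's theorem
(`exists_sublist_of_prod_eq`), combined with the fact that a word for 1 contains no letter exactly
once. Dyer's theorem follows from strong exchange once a product of p reflections is known to
descend to 1 in at most p length-decreasing steps (`Descends.mul_reflection`); the critical case is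
`exists_zpow_length_lt`, where the parity of inversions is used as a cocycle.

The topological input is that injective maps of Δ-complexes realize to closed embeddings
(`isClosedEmbedding_realization`), that a common point of two images lies on a common simplex
(`exists_of_realization_eq`), and that homotopies agreeing on an intersection of closed sets can be
pasted (`DeformsInto.union_range`). -/

/-! ### Parity of inversions, the strong exchange property, and Dyer's theorem -/

namespace CoxeterSystem

section Inversions

variable {B : Type*} {M : CoxeterMatrix B} {W : Type*} [Group W] (cs : CoxeterSystem M W)

open scoped Classical in
/-- The action of a simple reflection on pairs consisting of a group element and a sign. -/
noncomputable def signedConj (i : B) : Function.End (W × ZMod 2) :=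
  fun p => (cs.simple i * p.1 * cs.simple i, p.2 + if p.1 = cs.simple i then 1 else 0)

-- The sign changes whenever the conjugate of t reached so far equals the next letter. Undoing the
-- conjugation, this condition for the c-th letter from the right, counted from 0, reads t = s_j
-- (s_i s_j)^c.
open scoped Classical in
theorem signedConj_mul_pow (i j : B) (k : ℕ) (t : W) (e : ZMod 2) :
    ((cs.signedConj i * cs.signedConj j) ^ k) (t, e) =
      ((cs.simple i * cs.simple j) ^ k * t * ((cs.simple i * cs.simple j) ^ k)⁻¹,
        e + ∑ c ∈ Finset.range (2 * k),
          if t = cs.simple j * (cs.simple i * cs.simple j) ^ c then 1 else 0) := by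
  set g := cs.simple i * cs.simple j with hg
  have hb : ∀ l : ℕ, cs.simple j * g ^ l = (g ^ l)⁻¹ * cs.simple j := by
    intro l
    have : cs.simple j * g * (cs.simple j)⁻¹ = g⁻¹ := by simp [hg, mul_assoc]
    have h2 : cs.simple j * g ^ l * (cs.simple j)⁻¹ = (g⁻¹) ^ l := by rw [← conj_pow, this]
    rw [inv_pow] at h2
    rw [← h2]
    group
  induction k with
  | zero =>
    rw [pow_zero]
    change (t, e) = _
    simp
  | succ k ih =>
    have e1 : (g ^ k * t * (g ^ k)⁻¹ = cs.simple j) ↔ t = cs.simple j * g ^ (2 * k) := by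
      rw [two_mul, pow_add, ← mul_assoc, hb k]
      constructor
      · intro h; rw [← h]; group
      · rintro rfl; group
    have e2 : (cs.simple j * (g ^ k * t * (g ^ k)⁻¹) * cs.simple j = cs.simple i) ↔
        t = cs.simple j * g ^ (2 * k + 1) := by
      have e3 : cs.simple j * g ^ (2 * k + 1) =
          (g ^ k)⁻¹ * (cs.simple j * cs.simple i * cs.simple j) * g ^ k := by
        rw [show 2 * k + 1 = k + 1 + k by ring, pow_add, pow_add, pow_one, ← mul_assoc,
          ← mul_assoc, hb k]
        simp only [hg, mul_assoc]
      rw [e3]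
      constructor
      · intro h; rw [← h]; simp only [mul_assoc, simple_mul_simple_cancel_left,
          simple_mul_simple_self, inv_mul_cancel_left, inv_mul_cancel, mul_one]
      · rintro rfl
        simp [mul_assoc]
    rw [pow_succ']
    change (cs.signedConj i * cs.signedConj j) (((cs.signedConj i * cs.signedConj j) ^ k) (t, e)) = _
    rw [ih]
    change cs.signedConj i (cs.signedConj j _) = _
    simp only [signedConj, e1, e2]
    rw [show 2 * (k + 1) = 2 * k + 1 + 1 by ring, Finset.sum_range_succ, Finset.sum_range_succ]
    ext1
    · simp [hg, pow_succ', mul_assoc]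
    · simp only [add_assoc]

/-- With (s_i s_j)^m = 1, the 2m conditions are m conditions each listed twice, so the sign changes
cancel modulo two. -/
theorem isLiftable_signedConj : M.IsLiftable cs.signedConj := by
  classical
  intro i j
  funext p
  obtain ⟨t, e⟩ := p
  rw [signedConj_mul_pow, cs.simple_mul_simple_pow, two_mul, Finset.sum_range_add]
  simp only [pow_add, cs.simple_mul_simple_pow, one_mul, CharTwo.add_self_eq_zero]
  change _ = (t, e)
  simp

/-- The number modulo two of occurrences of `t` in the right inversion sequence of any word
for `w`. -/
noncomputable def inversionParity (w t : W) : ZMod 2 :=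
  (cs.lift ⟨cs.signedConj, cs.isLiftable_signedConj⟩ w (t, 0)).2

theorem lift_signedConj_apply (w t : W) (e : ZMod 2) :
    cs.lift ⟨cs.signedConj, cs.isLiftable_signedConj⟩ w (t, e) =
      (w * t * w⁻¹, e + cs.inversionParity w t) := by
  set φ := cs.lift ⟨cs.signedConj, cs.isLiftable_signedConj⟩ with hφ
  unfold inversionParity
  rw [← hφ]
  induction w using cs.simple_induction_left with
  | one =>
    rw [map_one]
    change (t, e) = (_, e + 0)
    simp
  | mul_simple_left w i ih =>
    have h : ∀ p, φ (cs.simple i * w) p = cs.signedConj i (φ w p) := by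
      intro p
      rw [map_mul, hφ, cs.lift_apply_simple]
      rfl
    have h0 : (φ w (t, 0)).1 = w * t * w⁻¹ := by
      have : ∀ (w : W) (p : W × ZMod 2), (φ w p).1 = w * p.1 * w⁻¹ := by
        intro w p
        induction w using cs.simple_induction_left with
        | one => rw [map_one]; change p.1 = _; simp
        | mul_simple_left w i ih =>
          rw [map_mul, hφ, cs.lift_apply_simple]
          change (cs.signedConj i (φ w p)).1 = _
          simp [signedConj, ih, mul_assoc]
      exact this w _
    rw [h, h, ih]
    simp only [signedConj]
    rw [h0]
    ext1
    · simp [mul_assoc]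
    · simp only [add_assoc]

theorem inversionParity_one (t : W) : cs.inversionParity 1 t = 0 := by
  unfold inversionParity
  rw [map_one]
  rfl

open scoped Classical in
theorem inversionParity_simple (i : B) (t : W) :
    cs.inversionParity (cs.simple i) t = if t = cs.simple i then 1 else 0 := by
  unfold inversionParity
  rw [cs.lift_apply_simple]
  simp [signedConj]

/-- This cocycle identity is the only tool for computing parities below; it is the sign component of
multiplicativity of the lifted action. -/
theorem inversionParity_mul (x y t : W) :
    cs.inversionParity (x * y) t =
      cs.inversionParity y t + cs.inversionParity x (y * t * y⁻¹) := by
  have h := cs.lift_signedConj_apply (x * y) t 0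
  rw [map_mul] at h
  change cs.lift ⟨cs.signedConj, cs.isLiftable_signedConj⟩ x
    (cs.lift ⟨cs.signedConj, cs.isLiftable_signedConj⟩ y (t, 0)) = _ at h
  rw [lift_signedConj_apply, lift_signedConj_apply] at h
  have := congrArg Prod.snd h
  simpa using this.symm

theorem inversionParity_wordProd [DecidableEq W] (ω : List B) (t : W) :
    cs.inversionParity (cs.wordProd ω) t = ((cs.rightInvSeq ω).count t : ZMod 2) := by
  classical
  induction ω with
  | nil => simp [inversionParity_one]
  | cons i ω ih =>
    rw [cs.wordProd_cons, inversionParity_mul, ih, inversionParity_simple, rightInvSeq,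
      List.count_cons]
    have e : cs.wordProd ω * t * (cs.wordProd ω)⁻¹ = cs.simple i ↔
        (cs.wordProd ω)⁻¹ * cs.simple i * cs.wordProd ω = t := by
      constructor
      · intro h; rw [← h]; group
      · rintro rfl; group
    simp only [e, beq_iff_eq]
    push_cast
    rfl

/-- Write t = u s u⁻¹. By the cocycle identity for u u⁻¹ = 1, the contributions of u⁻¹ and u cancel,
leaving the 1 of the middle letter. -/
theorem IsReflection.inversionParity_self {t : W} (ht : cs.IsReflection t) :
    cs.inversionParity t t = 1 := by
  obtain ⟨u, i, rfl⟩ := ht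
  have h1 : cs.inversionParity (u * u⁻¹) (u * cs.simple i * u⁻¹) = 0 := by
    rw [mul_inv_cancel, inversionParity_one]
  have e : u⁻¹ * (u * cs.simple i * u⁻¹) * u⁻¹⁻¹ = cs.simple i := by group
  rw [inversionParity_mul, e] at h1
  rw [inversionParity_mul, inversionParity_mul, e, inversionParity_simple, if_pos rfl,
    cs.inv_simple, simple_mul_simple_self, one_mul, add_left_comm, h1, add_zero]

theorem isRightInversion_of_inversionParity {w t : W} (h : cs.inversionParity w t = 1) :
    cs.IsRightInversion w t := by
  classical
  obtain ⟨ω, hω, rfl⟩ := cs.exists_isReduced w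
  apply cs.isRightInversion_of_mem_rightInvSeq hω
  rw [inversionParity_wordProd] at h
  rw [← List.count_pos_iff]
  by_contra h0
  have : List.count t (cs.rightInvSeq ω) = 0 := by omega
  rw [this] at h
  simp at h

/-- If t shortened w with parity 0, then w * t would have parity 1 at t, so t would also shorten w *
t, which is absurd. -/
theorem IsReflection.isRightInversion_iff {t : W} (ht : cs.IsReflection t) (w : W) :
    cs.IsRightInversion w t ↔ cs.inversionParity w t = 1 := by
  refine ⟨fun h => ?_, cs.isRightInversion_of_inversionParity⟩
  by_contra h1
  have h0 : cs.inversionParity w t = 0 := by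
    generalize cs.inversionParity w t = a at h1
    revert h1; revert a; decide
  have h2 : cs.inversionParity (w * t) t = 1 := by
    rw [inversionParity_mul, IsReflection.inversionParity_self cs ht]
    simp [h0]
  have h3 := (cs.isRightInversion_of_inversionParity h2).2
  rw [mul_assoc, ht.mul_self, mul_one] at h3
  exact absurd h.2 (by omega)

theorem IsReflection.inversionParity_eq_zero_iff {t : W} (ht : cs.IsReflection t) (w : W) :
    cs.inversionParity w t = 0 ↔ ¬ cs.IsRightInversion w t := by
  rw [IsReflection.isRightInversion_iff cs ht]
  generalize cs.inversionParity w t = a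
  revert a; decide

/-- The strong exchange property. -/
theorem exists_eraseIdx_of_isRightInversion {ω : List B} {t : W}
    (h : cs.IsRightInversion (cs.wordProd ω) t) :
    ∃ j < ω.length, cs.wordProd ω * t = cs.wordProd (ω.eraseIdx j) := by
  classical
  have h1 := (IsReflection.isRightInversion_iff cs h.1 _).1 h
  rw [inversionParity_wordProd] at h1
  have hm : t ∈ cs.rightInvSeq ω := by
    rw [← List.count_pos_iff]
    by_contra h0
    have : List.count t (cs.rightInvSeq ω) = 0 := by omega
    rw [this] at h1
    simp at h1
  obtain ⟨j, hj, e⟩ := List.mem_iff_getElem.1 hm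
  refine ⟨j, by simpa using hj, ?_⟩
  rw [← cs.wordProd_mul_getD_rightInvSeq, List.getD_eq_getElem _ _ hj, e]

/-! ### Pairs of reflections, descents and Dyer's theorem -/

theorem zpow_mul_of_involutive {G : Type*} [Group G] {q q' : G} (hq : q * q = 1)
    (hq' : q' * q' = 1) (k : ℤ) : (q * q') ^ k * q = q * (q * q') ^ (-k) := by
  have h1 : q * (q * q')⁻¹ * q⁻¹ = q * q' := by
    rw [mul_inv_rev, inv_eq_of_mul_eq_one_left hq, inv_eq_of_mul_eq_one_left hq', mul_assoc,
      mul_assoc, hq, mul_one]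
  have h2 : q * ((q * q')⁻¹) ^ k * q⁻¹ = (q * q') ^ k := by rw [← conj_zpow, h1]
  rw [← h2, inv_zpow']
  group

theorem IsReflection.mul_zpow {q q' : W} (hq : cs.IsReflection q) (hq' : cs.IsReflection q')
    (k : ℤ) : cs.IsReflection (q * (q * q') ^ k) := by
  have hgkq := zpow_mul_of_involutive hq.mul_self hq'.mul_self
  set g := q * q' with hg
  obtain ⟨c, hc | hc⟩ := Int.even_or_odd' k
  · have : q * g ^ k = g ^ (-c) * q * (g ^ (-c))⁻¹ := by
      rw [hgkq, hc, mul_assoc, ← zpow_neg, ← zpow_add]; congr 2; ring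
    rw [this]
    exact hq.conj _
  · have : q * g ^ k = g ^ (-c) * q' * (g ^ (-c))⁻¹ := by
      have e : q' = q * g := by rw [hg, ← mul_assoc, hq.mul_self, one_mul]
      rw [e, ← mul_assoc, hgkq, hc, ← zpow_neg, mul_assoc, mul_assoc, ← zpow_one_add, ← zpow_add]
      congr 2; ring
    rw [this]
    exact hq'.conj _

/-- If two distinct reflections `q`, `q'` both shorten `u`, then some element of the coset of `u`
modulo the powers of `q * q'` is shorter than `u`. -/
theorem exists_zpow_length_lt {u q q' : W} (hq : cs.IsRightInversion u q)
    (hq' : cs.IsRightInversion u q') (hne : q ≠ q') :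
    ∃ k : ℤ, cs.length (u * (q * q') ^ k) < cs.length u := by
  classical
  -- Write N for the parity and r_k = q g^k. If u is shortest in its coset, then N(uq, ·) and N(uq',
  -- ·) vanish on all r_k, hence so do N(g, ·) and N(g^j, ·), and N(r_j, r_k) = 1 for all j, k. This
  -- forces N(p, r_k) = 0 for every p, against N(q, q) = 1.
  by_contra! hmin
  set g := q * q' with hg
  have hqq := hq.1.mul_self
  have hqq' := hq'.1.mul_self
  have hqinv := hq.1.inv
  have hqinv' := hq'.1.inv
  have hgkq : ∀ k : ℤ, g ^ k * q = q * g ^ (-k) := zpow_mul_of_involutive hqq hqq'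
  have hr : ∀ k : ℤ, cs.IsReflection (q * g ^ k) := hq.1.mul_zpow cs hq'.1
  have hconj : ∀ j k : ℤ, g ^ j * (q * g ^ k) * (g ^ j)⁻¹ = q * g ^ (k - 2 * j) := by
    intro j k
    rw [← mul_assoc, hgkq, ← zpow_neg, mul_assoc, mul_assoc, ← zpow_add, ← zpow_add]
    congr 2; ring
  -- u q r_k = u g^k is no shorter than u, hence longer than u q.
  have hE : ∀ k : ℤ, cs.inversionParity (u * q) (q * g ^ k) = 0 := by
    intro k
    rw [IsReflection.inversionParity_eq_zero_iff cs (hr k)]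
    intro h
    have h1 := h.2
    have h2 : u * q * (q * g ^ k) = u * g ^ k := by
      rw [mul_assoc, ← mul_assoc q, hqq, one_mul]
    rw [h2] at h1
    have := hmin k
    have := hq.2
    omega
  have hE' : ∀ k : ℤ, cs.inversionParity (u * q') (q * g ^ k) = 0 := by
    intro k
    rw [IsReflection.inversionParity_eq_zero_iff cs (hr k)]
    intro h
    have h1 := h.2
    have h2 : u * q' * (q * g ^ k) = u * g ^ (k - 1) := by
      have : q' * q = g⁻¹ := by rw [hg, mul_inv_rev, hqinv, hqinv']
      rw [mul_assoc, ← mul_assoc q', this, ← zpow_neg_one, ← zpow_add]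
      congr 2; ring
    rw [h2] at h1
    have := hmin (k - 1)
    have := hq'.2
    omega
  have hg0 : ∀ k : ℤ, cs.inversionParity g (q * g ^ k) = 0 := by
    intro k
    have h1 := hE' k
    have h2 : u * q' = u * q * g := by rw [hg, mul_assoc, ← mul_assoc q, hqq, one_mul]
    have h3 := hconj 1 k
    rw [zpow_one] at h3
    rwa [h2, inversionParity_mul, h3, hE, add_zero] at h1
  have hgj : ∀ j k : ℤ, cs.inversionParity (g ^ j) (q * g ^ k) = 0 := by
    intro j
    induction j with
    | zero => intro k; rw [zpow_zero, inversionParity_one]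
    | succ j ih =>
      intro k
      have h3 := hconj 1 k
      rw [zpow_one] at h3
      rw [zpow_add, zpow_one, inversionParity_mul, hg0, h3, ih, add_zero]
    | pred j ih =>
      intro k
      have h3 := hconj 1 (k + 2)
      rw [zpow_one, mul_one, add_sub_cancel_right] at h3
      have h4 := ih (k + 2)
      have e : g ^ (-(j : ℤ)) = g ^ (-(j : ℤ) - 1) * g := by
        rw [← zpow_add_one]; congr 1; ring
      rwa [e, inversionParity_mul, hg0, h3, zero_add] at h4
  have hq1 : ∀ k : ℤ, cs.inversionParity q (q * g ^ k) = 1 := by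
    intro k
    have h1 := IsReflection.inversionParity_self cs (hr (-k))
    have h3 := hconj (-k) (-k)
    rw [inversionParity_mul, hgj, zero_add, h3] at h1
    rw [← h1]; congr 3; ring
  have hrr : ∀ j k : ℤ, cs.inversionParity (q * g ^ j) (q * g ^ k) = 1 := by
    intro j k
    rw [inversionParity_mul, hgj, zero_add, hconj, hq1]
  -- If the value at r_j changes on passing from p to s_i p, then s_i p = p r_j. This gives N(s_i p,
  -- r_k) = 1 for all k, so p r_k p⁻¹ = s_i for all k; then all r_k coincide, although r_0 = q and
  -- r_1 = q'.
  have hall : ∀ p : W, ∀ k : ℤ, cs.inversionParity p (q * g ^ k) = 0 := by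
    intro p
    induction p using cs.simple_induction_left with
    | one => intro k; rw [inversionParity_one]
    | mul_simple_left p i ih =>
      intro j
      rw [inversionParity_mul, ih, zero_add, inversionParity_simple, if_neg]
      intro hj
      have key : ∀ k : ℤ, q * g ^ k = q * g ^ j := by
        intro k
        have e1 : cs.simple i * p = p * (q * g ^ j) := by rw [← hj]; group
        have e2 : cs.inversionParity (cs.simple i * p) (q * g ^ k) = 1 := by
          have e3 : q * g ^ j * (q * g ^ k) * (q * g ^ j)⁻¹ = q * g ^ (2 * j - k) := by
            have : q * g ^ j * (q * g ^ k) * (q * g ^ j)⁻¹ =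
                q * (g ^ j * (q * g ^ k) * (g ^ j)⁻¹) * q⁻¹ := by group
            rw [this, hconj, ← mul_assoc, hqq, one_mul, hqinv, hgkq]
            congr 2; ring
          rw [e1, inversionParity_mul, hrr, e3, ih, add_zero]
        rw [inversionParity_mul, ih, zero_add, inversionParity_simple] at e2
        split_ifs at e2 with h5
        · rw [← hj] at h5
          simpa using h5
        · simp at e2
      apply hne
      have h0 := key 0
      have h1 := key 1
      rw [← h0, zpow_one, zpow_zero, mul_one, hg, ← mul_assoc, hqq, one_mul] at h1
      exact h1.symm
  have := hq1 0
  rw [hall] at this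
  exact zero_ne_one this

/-- `x` can be brought down to the identity by `p` right multiplications by reflections, each of
which decreases the length. -/
inductive Descends : ℕ → W → Prop
  | one : Descends 0 1
  | step {p : ℕ} {x t : W} (h : cs.IsRightInversion x t) (hx : Descends p (x * t)) :
      Descends (p + 1) x

/-- If t lengthens x, one extra step leads from x t back to x. Otherwise t and the first step r of
the descent both shorten x; if r ≠ t, some x g^k with g = r t is shorter than x. Go from x r to x
g^k and then to x t, each time by one reflection: both moves start below x in length, so the
induction applies twice and each adds at most one step. -/
theorem Descends.mul_reflection : ∀ (m : ℕ) (x : W), cs.length x = m → ∀ (p : ℕ) (t : W),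
    cs.Descends p x → cs.IsReflection t → ∃ p' ≤ p + 1, cs.Descends p' (x * t) := by
  intro m
  induction m using Nat.strong_induction_on with
  | _ m ih =>
    intro x hxm p t hp ht
    by_cases hxt : cs.IsRightInversion x t
    swap
    · refine ⟨p + 1, le_rfl, Descends.step (t := t) ⟨ht, ?_⟩ ?_⟩
      · have h1 := ht.length_mul_left_ne x
        rw [mul_assoc, ht.mul_self, mul_one]
        by_contra h2
        exact hxt ⟨ht, by omega⟩
      · rwa [mul_assoc, ht.mul_self, mul_one]
    cases hp with
    | one => exact absurd hxt.2 (by simp)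
    | @step p _ r hr hp =>
      by_cases hrt : r = t
      · subst hrt
        exact ⟨p, by omega, hp⟩
      obtain ⟨k, hk⟩ := cs.exists_zpow_length_lt hr hxt hrt
      set g := r * t with hg
      have hrefl : ∀ k : ℤ, cs.IsReflection (r * g ^ k) := hr.1.mul_zpow cs ht
      have h1 := ih _ (hxm ▸ hr.2) (x * r) rfl p _ hp (hrefl k)
      have e1 : x * r * (r * g ^ k) = x * g ^ k := by
        rw [mul_assoc, ← mul_assoc r, hr.1.mul_self, one_mul]
      rw [e1] at h1
      obtain ⟨p', hp', h1⟩ := h1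
      have h3 : cs.IsReflection (r * g ^ (k + 1))⁻¹ := (hrefl (k + 1)).isReflection_inv
      have e2 : x * g ^ k * (g ^ (-k) * t) = x * t := by group
      have e3 : g ^ (-k) * t = (r * g ^ (k + 1))⁻¹ := by
        rw [mul_inv_rev, ← zpow_neg, neg_add, zpow_add, hr.1.inv, mul_assoc]
        congr 1
        rw [zpow_neg_one, hg, mul_inv_rev, hr.1.inv, ht.inv, mul_assoc, hr.1.mul_self, mul_one]
      obtain ⟨p'', hp'', h4⟩ := ih _ (hxm ▸ hk) (x * g ^ k) rfl p' _ h1 (e3 ▸ h3)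
      rw [e2] at h4
      exact ⟨p'', by omega, h4⟩

theorem exists_descends_prod (L : List W) (hL : ∀ t ∈ L, cs.IsReflection t) :
    ∃ p ≤ L.length, cs.Descends p L.prod := by
  induction L using List.reverseRecOn with
  | nil => exact ⟨0, le_rfl, by simpa using Descends.one⟩
  | append_singleton L t ih =>
    obtain ⟨p, hp, h⟩ := ih fun r hr => hL r (by simp [hr])
    obtain ⟨p', hp', h'⟩ := Descends.mul_reflection cs _ _ rfl p t h (hL t (by simp))
    refine ⟨p', by simp; omega, by simpa using h'⟩

/-- By strong exchange, each step of the descent deletes one letter. -/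
theorem Descends.exists_sublist {p : ℕ} {x : W} (h : cs.Descends p x) :
    ∀ ω : List B, cs.wordProd ω = x →
      ∃ ω' : List B, ω'.Sublist ω ∧ cs.wordProd ω' = 1 ∧ ω.length = ω'.length + p := by
  induction h with
  | one => intro ω hω; exact ⟨ω, List.Sublist.refl _, hω, rfl⟩
  | @step p x t ht _ ih =>
    rintro ω rfl
    obtain ⟨j, hj, e⟩ := cs.exists_eraseIdx_of_isRightInversion ht
    obtain ⟨ω', h1, h2, h3⟩ := ih _ e.symm
    refine ⟨ω', h1.trans (List.eraseIdx_sublist _ _), h2, ?_⟩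
    rw [List.length_eraseIdx_of_lt hj] at h3
    omega

/-- Dyer's theorem: a word whose product is a product of `p` reflections becomes a word for the
identity after the deletion of at most `p` letters. -/
theorem exists_sublist_of_prod_eq (ω : List B) (L : List W) (hL : ∀ t ∈ L, cs.IsReflection t)
    (h : cs.wordProd ω = L.prod) :
    ∃ ω' : List B, ω'.Sublist ω ∧ cs.wordProd ω' = 1 ∧ ω.length ≤ ω'.length + L.length := by
  obtain ⟨p, hp, hd⟩ := cs.exists_descends_prod L hL
  obtain ⟨ω', h1, h2, h3⟩ := Descends.exists_sublist cs hd ω h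
  exact ⟨ω', h1, h2, by omega⟩

end Inversions

end CoxeterSystem

/-! ### The geometric representation -/

namespace CoxeterSystem

section Geometric

variable {B : Type*} {M : CoxeterMatrix B} {W : Type*} [Group W] (cs : CoxeterSystem M W)

/-- The coroot of a simple reflection, as a linear form on the space spanned by simple roots. -/
noncomputable def simpleCoroot (M : CoxeterMatrix B) (i : B) : Module.Dual ℝ (B →₀ ℝ) :=
  Finsupp.linearCombination ℝ fun j => -2 * Real.cos (Real.pi / M i j)

theorem simpleCoroot_single (i j : B) :
    simpleCoroot M i (Finsupp.single j 1) = -2 * Real.cos (Real.pi / M i j) := by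
  simp [simpleCoroot]

theorem simpleCoroot_self (i : B) : simpleCoroot M i (Finsupp.single i 1) = 2 := by
  rw [simpleCoroot_single]
  simp

/-- The action of a simple reflection in the geometric representation. -/
noncomputable def simpleReflection (M : CoxeterMatrix B) (i : B) : (B →₀ ℝ) ≃ₗ[ℝ] (B →₀ ℝ) :=
  Module.reflection (simpleCoroot_self (M := M) i)

-- Powers of a product of two reflections have coefficients given by Chebyshev polynomials S_k at 2
-- cos θ, with θ = 2π/m and S_k(2 cos θ) sin θ = sin((k+1)θ). For m ≥ 3 one may divide by sin θ; for
-- m = 2 it vanishes, so that case is separate.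
open Polynomial.Chebyshev in
theorem isLiftable_simpleReflection : M.IsLiftable (simpleReflection M) := by
  intro i j
  set c := Real.cos (Real.pi / M i j) with hc
  have hij : simpleCoroot M i (Finsupp.single j 1) = -2 * c := simpleCoroot_single i j
  have hji : simpleCoroot M j (Finsupp.single i 1) = -2 * c := by
    rw [simpleCoroot_single, M.symmetric]
  have ht : simpleCoroot M i (Finsupp.single j 1) * simpleCoroot M j (Finsupp.single i 1) - 2 =
      2 * Real.cos (2 * (Real.pi / M i j)) := by
    rw [hij, hji, Real.cos_two_mul]; ring
  ext1 z
  obtain h0 | h1 | h2 | h3 : M i j = 0 ∨ M i j = 1 ∨ M i j = 2 ∨ 3 ≤ M i j := by omega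
  · simp [h0]
  · have : i = j := by
      by_contra h
      exact M.off_diagonal i j h h1
    subst this
    simp [simpleReflection, Module.involutive_reflection _ z, LinearEquiv.mul_apply]
  · have hc0 : c = 0 := by rw [hc, h2]; norm_num
    have key := Module.reflection_mul_reflection_pow_apply (simpleCoroot_self (M := M) i)
      (simpleCoroot_self (M := M) j) 2 z
    rw [hij, hji, hc0] at key
    rw [h2]
    refine key.trans ?_
    norm_num
    module
  · have hm : (0 : ℝ) < M i j := by positivity
    have hm3 : (3 : ℝ) ≤ M i j := by exact_mod_cast h3
    set θ := 2 * (Real.pi / M i j) with hθ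
    have hmθ : (M i j : ℝ) * θ = 2 * Real.pi := by rw [hθ]; field_simp
    have hsin : Real.sin θ ≠ 0 := by
      apply ne_of_gt
      apply Real.sin_pos_of_pos_of_lt_pi
      · have := Real.pi_pos
        positivity
      · have : 3 * θ ≤ 2 * Real.pi := by
          rw [← hmθ]
          gcongr
        linarith [Real.pi_pos]
    have key := Module.reflection_mul_reflection_pow_apply (simpleCoroot_self (M := M) i)
      (simpleCoroot_self (M := M) j) (M i j) z
    refine key.trans ?_
    rw [ht]
    have hS := fun k : ℤ => S_two_mul_real_cos θ k
    obtain ⟨k, hk | hk⟩ := Nat.even_or_odd' (M i j)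
    · have e1 : ((M i j : ℤ) - 2) / 2 = k - 1 := by omega
      have e2 : ((M i j : ℤ) - 1) / 2 = k - 1 := by omega
      have hz : (S ℝ ((k : ℤ) - 1)).eval (2 * Real.cos θ) = 0 := by
        have h := hS ((k : ℤ) - 1)
        have : (((k : ℤ) - 1 : ℤ) + 1 : ℝ) * θ = Real.pi := by
          rw [hk] at hmθ
          push_cast at hmθ ⊢
          linarith
        rw [this, Real.sin_pi] at h
        exact (mul_eq_zero.1 h).resolve_right hsin
      rw [e1, e2, hz]
      simp
    · have e1 : ((M i j : ℤ) - 2) / 2 = k - 1 := by omega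
      have e2 : ((M i j : ℤ) - 1) / 2 = k := by omega
      have e3 : ((M i j : ℤ) - 3) / 2 = k - 1 := by omega
      have e4 : (M i j : ℤ) / 2 = k := by omega
      have hz : (S ℝ (k : ℤ)).eval (2 * Real.cos θ) +
          (S ℝ ((k : ℤ) - 1)).eval (2 * Real.cos θ) = 0 := by
        have h := hS (k : ℤ)
        have h' := hS ((k : ℤ) - 1)
        -- Here m = 2k + 1, so the two angles (k+1)θ and kθ add up to 2π and their sines cancel.
        have e : (((k : ℤ) : ℝ) + 1) * θ = 2 * Real.pi - (((k : ℤ) - 1 : ℤ) + 1 : ℝ) * θ := by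
          rw [hk] at hmθ
          push_cast at hmθ ⊢
          linarith
        rw [e, Real.sin_two_pi_sub] at h
        have h5 : ((S ℝ (k : ℤ)).eval (2 * Real.cos θ) +
          (S ℝ ((k : ℤ) - 1)).eval (2 * Real.cos θ)) * Real.sin θ = 0 := by
          rw [add_mul, h, h']; ring
        exact (mul_eq_zero.1 h5).resolve_right hsin
      rw [e1, e2, e3, e4, hz]
      simp

/-- The geometric representation of a Coxeter group. -/
noncomputable def geometricRep : W →* ((B →₀ ℝ) ≃ₗ[ℝ] (B →₀ ℝ)) :=
  cs.lift ⟨simpleReflection M, isLiftable_simpleReflection⟩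

theorem geometricRep_simple (i : B) (v : B →₀ ℝ) :
    cs.geometricRep (cs.simple i) v = v - simpleCoroot M i v • Finsupp.single i 1 := by
  rw [geometricRep, cs.lift_apply_simple]
  exact Module.reflection_apply _ _

end Geometric

/-! ### Parabolic subgroups -/

variable {n : ℕ} {M : CoxeterMatrix (Fin n)} {W : Type*} [Group W] (cs : CoxeterSystem M W)

theorem geometricRep_apply_of_notMem {T : Finset (Fin n)} {w : W} (hw : w ∈ cs.parabolic T)
    {j : Fin n} (hj : j ∉ T) : ∀ v, cs.geometricRep w v j = v j := by
  unfold parabolic at hw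
  induction hw using Subgroup.closure_induction with
  | mem x hx =>
    obtain ⟨i, hi, rfl⟩ := hx
    intro v
    have : i ≠ j := by rintro rfl; exact hj hi
    rw [geometricRep_simple]
    simp [this]
  | one => simp
  | mul x y _ _ hx hy => intro v; rw [map_mul, LinearEquiv.mul_apply, hx, hy]
  | inv x _ hx =>
    intro v
    rw [← hx, ← LinearEquiv.mul_apply, ← map_mul, mul_inv_cancel, map_one]
    rfl

/-- The simple reflection s_j negates the j-th simple root, while W_T preserves the j-th coordinate
if j ∉ T. This is all that the geometric representation is needed for. -/
theorem simple_mem_parabolic_iff {T : Finset (Fin n)} {j : Fin n} :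
    cs.simple j ∈ cs.parabolic T ↔ j ∈ T := by
  refine ⟨fun h => ?_, fun h => Subgroup.subset_closure ⟨j, h, rfl⟩⟩
  by_contra hj
  have h1 := cs.geometricRep_apply_of_notMem h hj (Finsupp.single j 1)
  rw [geometricRep_simple, simpleCoroot_self] at h1
  norm_num at h1

theorem parabolic_mono {T U : Finset (Fin n)} (h : T ⊆ U) : cs.parabolic T ≤ cs.parabolic U :=
  Subgroup.closure_mono (Set.image_mono (by exact_mod_cast h))

theorem parabolic_univ : cs.parabolic Finset.univ = ⊤ := by
  unfold parabolic
  rw [Finset.coe_univ, Set.image_univ, subgroup_closure_range_simple]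

theorem wordProd_mem_parabolic {T : Finset (Fin n)} {ω : List (Fin n)} (h : ∀ i ∈ ω, i ∈ T) :
    cs.wordProd ω ∈ cs.parabolic T := by
  apply list_prod_mem
  intro r hr
  obtain ⟨i, hi, rfl⟩ := List.mem_map.1 hr
  exact cs.simple_mem_parabolic_iff.2 (h i hi)

theorem exists_word_of_mem_parabolic {T : Finset (Fin n)} {x : W} (hx : x ∈ cs.parabolic T) :
    ∃ ω : List (Fin n), (∀ i ∈ ω, i ∈ T) ∧ cs.wordProd ω = x := by
  unfold parabolic at hx
  induction hx using Subgroup.closure_induction with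
  | mem x hx => obtain ⟨i, hi, rfl⟩ := hx; exact ⟨[i], by simpa using hi, by simp⟩
  | one => exact ⟨[], by simp, by simp⟩
  | mul x y _ _ hx hy =>
    obtain ⟨a, ha, rfl⟩ := hx
    obtain ⟨b, hb, rfl⟩ := hy
    refine ⟨a ++ b, ?_, cs.wordProd_append a b⟩
    intro i hi
    exact (List.mem_append.1 hi).elim (ha i) (hb i)
  | inv x _ hx =>
    obtain ⟨a, ha, rfl⟩ := hx
    exact ⟨a.reverse, by simpa using ha, cs.wordProd_reverse a⟩

/-- A letter that occurs exactly once in a word forces the product to be different from `1`. -/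
theorem wordProd_append_cons_ne_one {T : Finset (Fin n)} {j : Fin n} (hj : j ∉ T)
    {a b : List (Fin n)} (ha : ∀ i ∈ a, i ∈ T) (hb : ∀ i ∈ b, i ∈ T) :
    cs.wordProd (a ++ j :: b) ≠ 1 := by
  intro h
  apply hj
  rw [← cs.simple_mem_parabolic_iff]
  rw [wordProd_append, wordProd_cons] at h
  have : cs.simple j = (cs.wordProd a)⁻¹ * (cs.wordProd b)⁻¹ := by
    calc cs.simple j = (cs.wordProd a)⁻¹ * (cs.wordProd a * (cs.simple j * cs.wordProd b)) *
        (cs.wordProd b)⁻¹ := by group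
      _ = _ := by rw [h, mul_one]
  rw [this]
  exact mul_mem (inv_mem (cs.wordProd_mem_parabolic ha)) (inv_mem (cs.wordProd_mem_parabolic hb))

/-- Consequently a letter available only once in a word cannot survive in the subwords for 1 that
Dyer's theorem provides. -/
theorem count_ne_one_of_wordProd_eq_one {ω : List (Fin n)} (h : cs.wordProd ω = 1) (j : Fin n) :
    ω.count j ≠ 1 := by
  intro hc
  have hm : j ∈ ω := by rw [← List.count_pos_iff]; omega
  obtain ⟨a, b, rfl⟩ := List.append_of_mem hm
  rw [List.count_append, List.count_cons_self] at hc
  have ha : j ∉ a := by rw [← List.count_eq_zero]; omega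
  have hb : j ∉ b := by rw [← List.count_eq_zero]; omega
  refine cs.wordProd_append_cons_ne_one (T := Finset.univ.erase j) (by simp) ?_ ?_ h
  · intro i hi
    simp only [Finset.mem_erase, Finset.mem_univ, and_true]
    rintro rfl; exact ha hi
  · intro i hi
    simp only [Finset.mem_erase, Finset.mem_univ, and_true]
    rintro rfl; exact hb hi

/-- Strong exchange in a word over T writes s_i as a product of elements of W_T. -/
theorem mem_of_isRightDescent {T : Finset (Fin n)} {x : W} (hx : x ∈ cs.parabolic T) {i : Fin n}
    (hi : cs.IsRightDescent x i) : i ∈ T := by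
  obtain ⟨ω, hω, rfl⟩ := cs.exists_word_of_mem_parabolic hx
  rw [← isRightInversion_simple_iff_isRightDescent] at hi
  obtain ⟨k, -, e⟩ := cs.exists_eraseIdx_of_isRightInversion hi
  rw [← cs.simple_mem_parabolic_iff]
  have : cs.simple i = (cs.wordProd ω)⁻¹ * cs.wordProd (ω.eraseIdx k) := by rw [← e]; group
  rw [this]
  exact mul_mem (inv_mem hx)
    (cs.wordProd_mem_parabolic fun i hi => hω i (List.mem_of_mem_eraseIdx hi))

/-- Peel off right descents: for an element of both subgroups they lie in T and in U. -/
theorem parabolic_inf (T U : Finset (Fin n)) :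
    cs.parabolic T ⊓ cs.parabolic U = cs.parabolic (T ∩ U) := by
  apply le_antisymm
  swap
  · exact le_inf (cs.parabolic_mono Finset.inter_subset_left)
      (cs.parabolic_mono Finset.inter_subset_right)
  intro x
  induction hm : cs.length x using Nat.strong_induction_on generalizing x with
  | _ m ih =>
    rintro ⟨hT, hU⟩
    by_cases h1 : x = 1
    · rw [h1]; exact one_mem _
    obtain ⟨i, hi⟩ := cs.exists_rightDescent_of_ne_one h1
    have hiT := cs.mem_of_isRightDescent hT hi
    have hiU := cs.mem_of_isRightDescent hU hi
    have h2 := ih _ (hm ▸ hi) rfl ⟨mul_mem hT (cs.simple_mem_parabolic_iff.2 hiT),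
      mul_mem hU (cs.simple_mem_parabolic_iff.2 hiU)⟩
    have h3 := mul_mem h2 (cs.simple_mem_parabolic_iff.2 (Finset.mem_inter.2 ⟨hiT, hiU⟩))
    rwa [simple_mul_simple_cancel_right] at h3

/-! ### Reflection lengths and intervals in parabolic subgroups -/

open IntervalGroup

theorem closure_parabolicReflections (T : Finset (Fin n)) :
    Subgroup.closure (cs.parabolicReflections T) = cs.parabolic T := by
  apply le_antisymm
  · rw [Subgroup.closure_le]
    exact cs.parabolicReflections_subset T
  · apply Subgroup.closure_mono
    rintro _ ⟨i, hi, rfl⟩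
    exact cs.simple_mem_parabolicReflections hi

theorem isReflection_of_mem_parabolicReflections {T : Finset (Fin n)} {t : W}
    (ht : t ∈ cs.parabolicReflections T) : cs.IsReflection t := by
  obtain ⟨u, -, i, -, rfl⟩ := ht
  exact ⟨u, i, rfl⟩

theorem parabolicReflections_mono {T U : Finset (Fin n)} (h : T ⊆ U) :
    cs.parabolicReflections T ⊆ cs.parabolicReflections U := by
  rintro _ ⟨u, hu, i, hi, rfl⟩
  exact ⟨u, cs.parabolic_mono h hu, i, h hi, rfl⟩

theorem conj_mem_parabolicReflections_of_mem {T : Finset (Fin n)} {t u : W}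
    (ht : t ∈ cs.parabolicReflections T) (hu : u ∈ cs.parabolic T) :
    u * t * u⁻¹ ∈ cs.parabolicReflections T := by
  obtain ⟨v, hv, i, hi, rfl⟩ := ht
  exact ⟨u * v, mul_mem hu hv, i, hi, by group⟩

/-- Deleting letters from a word amounts to multiplying by reflections. -/
theorem exists_reflections_of_sublist {T : Finset (Fin n)} {ω' ω : List (Fin n)}
    (h : ω'.Sublist ω) (hω : ∀ i ∈ ω, i ∈ T) :
    ∃ L : List W, (∀ t ∈ L, t ∈ cs.parabolicReflections T) ∧
      L.length + ω'.length = ω.length ∧ (cs.wordProd ω')⁻¹ * cs.wordProd ω = L.prod := by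
  induction h with
  | slnil => exact ⟨[], by simp, rfl, by simp⟩
  | @cons l₁ l₂ a h ih =>
    obtain ⟨L, h1, h2, h3⟩ := ih fun i hi => hω i (List.mem_cons_of_mem _ hi)
    refine ⟨(cs.wordProd l₁)⁻¹ * cs.simple a * (cs.wordProd l₁)⁻¹⁻¹ :: L, ?_, ?_, ?_⟩
    · intro t ht
      rcases List.mem_cons.1 ht with rfl | ht
      · exact cs.conj_mem_parabolicReflections_of_mem
          (cs.simple_mem_parabolicReflections (hω a List.mem_cons_self))
          (inv_mem (cs.wordProd_mem_parabolic fun i hi =>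
            hω i (List.mem_cons_of_mem _ (h.subset hi))))
      · exact h1 t ht
    · simp only [List.length_cons]; omega
    · rw [wordProd_cons, List.prod_cons, ← h3]; group
  | @cons_cons l₁ l₂ a h ih =>
    obtain ⟨L, h1, h2, h3⟩ := ih fun i hi => hω i (List.mem_cons_of_mem _ hi)
    refine ⟨L, h1, by simp only [List.length_cons]; omega, ?_⟩
    rw [wordProd_cons, wordProd_cons, ← h3]
    group

/-- The length with respect to all reflections. -/
noncomputable def reflectionLength (x : W) : ℕ := IntervalGroup.length (cs.parabolicReflections Finset.univ) x

theorem mem_closure_univ (x : W) :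
    x ∈ Subgroup.closure (cs.parabolicReflections Finset.univ) := by
  rw [closure_parabolicReflections, parabolic_univ]
  trivial

theorem reflectionLength_mul_le (x y : W) :
    cs.reflectionLength (x * y) ≤ cs.reflectionLength x + cs.reflectionLength y :=
  IntervalGroup.length_mul_le (cs.inv_mem_parabolicReflections _) (cs.mem_closure_univ x) (cs.mem_closure_univ y)

theorem reflectionLength_le_of_sublist {ω' ω : List (Fin n)} (h : ω'.Sublist ω) :
    cs.reflectionLength ((cs.wordProd ω')⁻¹ * cs.wordProd ω) + ω'.length ≤ ω.length := by
  obtain ⟨L, h1, h2, h3⟩ := cs.exists_reflections_of_sublist (T := Finset.univ) h (by simp)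
  rw [h3, ← h2]
  have := IntervalGroup.length_le h1
  unfold reflectionLength
  omega

theorem exists_sublist_reflectionLength (ω : List (Fin n)) :
    ∃ ω' : List (Fin n), ω'.Sublist ω ∧ cs.wordProd ω' = 1 ∧
      ω.length ≤ ω'.length + cs.reflectionLength (cs.wordProd ω) := by
  obtain ⟨L, h1, h2, h3⟩ := exists_length_eq (cs.inv_mem_parabolicReflections Finset.univ)
    (cs.mem_closure_univ (cs.wordProd ω))
  have := cs.exists_sublist_of_prod_eq ω L
    (fun t ht => cs.isReflection_of_mem_parabolicReflections (h1 t ht)) h3.symm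
  rwa [h2] at this

/-- Reflection lengths in a parabolic subgroup agree with those in the whole group. -/
theorem length_parabolicReflections {T : Finset (Fin n)} {x : W} (hx : x ∈ cs.parabolic T) :
    IntervalGroup.length (cs.parabolicReflections T) x = cs.reflectionLength x := by
  apply le_antisymm
  · obtain ⟨ω, hω, rfl⟩ := cs.exists_word_of_mem_parabolic hx
    -- The few letters deleted from a word over T correspond to reflections of W_T itself, which
    -- bounds the length in W_T.
    obtain ⟨ω', h1, h2, h3⟩ := cs.exists_sublist_reflectionLength ω
    obtain ⟨L, h4, h5, h6⟩ := cs.exists_reflections_of_sublist h1 hω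
    rw [h2, inv_one, one_mul] at h6
    have := IntervalGroup.length_le h4
    rw [← h6] at this
    omega
  · rw [← closure_parabolicReflections] at hx
    obtain ⟨L, h1, h2, rfl⟩ := exists_length_eq (cs.inv_mem_parabolicReflections T) hx
    rw [← h2]
    exact IntervalGroup.length_le fun r hr => cs.parabolicReflections_mono (Finset.subset_univ T) (h1 r hr)

/-! ### Coxeter elements, their intervals and the simplices of K -/

theorem coxeterElement_mem_parabolic (T : Finset (Fin n)) :
    cs.coxeterElement T ∈ cs.parabolic T :=
  cs.wordProd_mem_parabolic fun _ hi => (Finset.mem_sort _).1 hi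

/-- All letters of the defining word are distinct, so its only subword with product 1 is empty. -/
theorem reflectionLength_coxeterElement (T : Finset (Fin n)) :
    cs.reflectionLength (cs.coxeterElement T) = T.card := by
  apply le_antisymm
  · have h := cs.reflectionLength_le_of_sublist (List.nil_sublist T.sort)
    simpa [coxeterElement] using h
  · obtain ⟨ω', h1, h2, h3⟩ := cs.exists_sublist_reflectionLength T.sort
    have h4 : ω' = [] := by
      rw [List.eq_nil_iff_forall_not_mem]
      intro j hj
      exact cs.count_ne_one_of_wordProd_eq_one h2 j
        (List.count_eq_one_of_mem ((Finset.sort_nodup _ _).sublist h1) hj)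
    rw [h4] at h3
    simpa [coxeterElement] using h3

theorem filter_sort {T U : Finset (Fin n)} (h : U ⊆ T) :
    T.sort.filter (· ∈ U) = U.sort := by
  apply List.Perm.eq_of_pairwise (le := (· ≤ ·))
  · intro a b _ _; exact le_antisymm
  · exact (Finset.pairwise_sort _ _).filter _
  · exact Finset.pairwise_sort _ _
  · rw [List.perm_ext_iff_of_nodup ((Finset.sort_nodup _ _).filter _) (Finset.sort_nodup _ _)]
    intro a
    simp only [List.mem_filter, Finset.mem_sort, decide_eq_true_eq]
    exact ⟨fun h => h.2, fun ha => ⟨h ha, ha⟩⟩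

theorem mem_interval_coxeterElement_iff {T : Finset (Fin n)} {x : W} :
    x ∈ interval (cs.parabolicReflections T) (cs.coxeterElement T) ↔
      x ∈ cs.parabolic T ∧
        cs.reflectionLength x + cs.reflectionLength (x⁻¹ * cs.coxeterElement T) = T.card := by
  unfold interval
  rw [Set.mem_ofPred_eq, closure_parabolicReflections]
  refine and_congr_right fun hx => ?_
  rw [cs.length_parabolicReflections hx, cs.length_parabolicReflections
    (mul_mem (inv_mem hx) (cs.coxeterElement_mem_parabolic T)),
    cs.length_parabolicReflections (cs.coxeterElement_mem_parabolic T),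
    reflectionLength_coxeterElement]

/-- Deleting the letters outside U from w_T costs at most |T| - |U| reflections; the rest is the
triangle inequality. -/
theorem mem_interval_of_subset {T U : Finset (Fin n)} (h : U ⊆ T) {x : W}
    (hx : x ∈ interval (cs.parabolicReflections U) (cs.coxeterElement U)) :
    x ∈ interval (cs.parabolicReflections T) (cs.coxeterElement T) := by
  rw [mem_interval_coxeterElement_iff] at hx ⊢
  refine ⟨cs.parabolic_mono h hx.1, ?_⟩
  have h1 := cs.reflectionLength_le_of_sublist
    (show U.sort.Sublist T.sort by rw [← filter_sort h]; exact List.filter_sublist)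
  have h2 := cs.reflectionLength_mul_le x (x⁻¹ * cs.coxeterElement T)
  have h3 := cs.reflectionLength_mul_le (x⁻¹ * cs.coxeterElement U)
    ((cs.coxeterElement U)⁻¹ * cs.coxeterElement T)
  rw [mul_inv_cancel_left, reflectionLength_coxeterElement] at h2
  rw [mul_assoc, mul_inv_cancel_left] at h3
  rw [Finset.length_sort, Finset.length_sort] at h1
  change cs.reflectionLength ((cs.coxeterElement U)⁻¹ * cs.coxeterElement T) + _ ≤ _ at h1
  have h4 := hx.2
  omega

theorem mem_interval_of_mem_parabolic {T U : Finset (Fin n)} (h : U ⊆ T) {x : W}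
    (hx : x ∈ interval (cs.parabolicReflections T) (cs.coxeterElement T))
    (hxU : x ∈ cs.parabolic U) :
    x ∈ interval (cs.parabolicReflections U) (cs.coxeterElement U) := by
  rw [mem_interval_coxeterElement_iff] at hx ⊢
  refine ⟨hxU, ?_⟩
  obtain ⟨ξ, hξ, e⟩ := cs.exists_word_of_mem_parabolic (inv_mem hxU)
  have e1 : cs.wordProd (ξ ++ T.sort) = x⁻¹ * cs.coxeterElement T := by
    rw [wordProd_append, e, coxeterElement]
  obtain ⟨ω', h1, h2, h3⟩ := cs.exists_sublist_reflectionLength (ξ ++ T.sort)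
  rw [e1, List.length_append, Finset.length_sort] at h3
  -- A letter outside U occurs at most once in the whole word, so it cannot occur in a subword for
  -- 1. Hence the same subword sits in the word for x⁻¹ w_U and bounds its reflection length.
  have h4 : ∀ j ∈ ω', j ∈ U := by
    intro j hj
    by_contra hjU
    have hc := h1.count_le j
    have hξj : ξ.count j = 0 := List.count_eq_zero.2 fun hm => hjU (hξ j hm)
    have hT : T.sort.count j ≤ 1 := List.nodup_iff_count_le_one.1 (Finset.sort_nodup _ _) j
    rw [List.count_append] at hc
    have hp := List.count_pos_iff.2 hj
    exact cs.count_ne_one_of_wordProd_eq_one h2 j (by omega)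
  have h5 : ω'.Sublist (ξ ++ U.sort) := by
    have h6 := h1.filter (· ∈ U)
    rw [List.filter_eq_self.2 (by simpa using h4), List.filter_append, filter_sort h,
      List.filter_eq_self.2 (by simpa using hξ)] at h6
    exact h6
  have h7 := cs.reflectionLength_le_of_sublist h5
  rw [h2, inv_one, one_mul, wordProd_append, e, List.length_append, Finset.length_sort] at h7
  change cs.reflectionLength (x⁻¹ * cs.coxeterElement U) + _ ≤ _ at h7
  have h8 := cs.reflectionLength_mul_le x (x⁻¹ * cs.coxeterElement U)
  rw [mul_inv_cancel_left, reflectionLength_coxeterElement] at h8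
  have h9 := hx.2
  have h10 := Finset.card_le_card h
  omega

/-- With all lengths taken in W, only membership in the interval still depends on T. -/
theorem isSimplexOfK_iff {T : Finset (Fin n)} {d : ℕ} {x : Fin d → W} :
    cs.IsSimplexOfK T x ↔
      (∀ k, x k ∈ interval (cs.parabolicReflections T) (cs.coxeterElement T)) ∧
      (∀ k, x k ≠ 1) ∧ ∑ k, cs.reflectionLength (x k) = cs.reflectionLength (List.ofFn x).prod ∧
      (List.ofFn x).prod ∈ interval (cs.parabolicReflections T) (cs.coxeterElement T) := by
  have key : (∀ k, x k ∈ interval (cs.parabolicReflections T) (cs.coxeterElement T)) →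
      (List.ofFn x).prod ∈ interval (cs.parabolicReflections T) (cs.coxeterElement T) →
      (∑ k, IntervalGroup.length (cs.parabolicReflections T) (x k) =
        IntervalGroup.length (cs.parabolicReflections T) (List.ofFn x).prod ↔
      ∑ k, cs.reflectionLength (x k) = cs.reflectionLength (List.ofFn x).prod) := by
    intro h1 h2
    rw [cs.length_parabolicReflections (cs.mem_interval_coxeterElement_iff.1 h2).1]
    rw [Finset.sum_congr rfl fun k _ =>
      cs.length_parabolicReflections (cs.mem_interval_coxeterElement_iff.1 (h1 k)).1]
  constructor
  · rintro ⟨h1, h2, h3, h4⟩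
    exact ⟨h1, h2, (key h1 h4).1 h3, h4⟩
  · rintro ⟨h1, h2, h3, h4⟩
    exact ⟨h1, h2, (key h1 h4).2 h3, h4⟩

theorem IsSimplexOfK.mono {T U : Finset (Fin n)} (h : U ⊆ T) {d : ℕ} {x : Fin d → W}
    (hx : cs.IsSimplexOfK U x) : cs.IsSimplexOfK T x := by
  rw [isSimplexOfK_iff] at hx ⊢
  exact ⟨fun k => cs.mem_interval_of_subset h (hx.1 k), hx.2.1, hx.2.2.1,
    cs.mem_interval_of_subset h hx.2.2.2⟩

theorem mem_interval_inter {T U : Finset (Fin n)} {x : W}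
    (hT : x ∈ interval (cs.parabolicReflections T) (cs.coxeterElement T))
    (hU : x ∈ interval (cs.parabolicReflections U) (cs.coxeterElement U)) :
    x ∈ interval (cs.parabolicReflections (T ∩ U)) (cs.coxeterElement (T ∩ U)) := by
  refine cs.mem_interval_of_mem_parabolic Finset.inter_subset_left hT ?_
  rw [← parabolic_inf]
  exact ⟨(cs.mem_interval_coxeterElement_iff.1 hT).1, (cs.mem_interval_coxeterElement_iff.1 hU).1⟩

theorem IsSimplexOfK.inter {T U : Finset (Fin n)} {d : ℕ} {x : Fin d → W}
    (hT : cs.IsSimplexOfK T x) (hU : cs.IsSimplexOfK U x) : cs.IsSimplexOfK (T ∩ U) x := by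
  rw [isSimplexOfK_iff] at hT hU ⊢
  exact ⟨fun k => cs.mem_interval_inter (hT.1 k) (hU.1 k), hT.2.1, hT.2.2.1,
    cs.mem_interval_inter hT.2.2.2 hU.2.2.2⟩

end CoxeterSystem

/-! ### Maps of Δ-complexes -/

namespace stdSimplex

theorem map_succAbove_apply {n : ℕ} (j : Fin (n + 2)) (t : stdSimplex ℝ (Fin (n + 1)))
    (k : Fin (n + 1)) : map j.succAbove t (j.succAbove k) = t k := by
  rw [map_coe, FunOnFinite.linearMap_apply_apply, Finset.sum_eq_single k]
  · intro b hb hbk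
    exact absurd (Fin.succAbove_right_injective (Finset.mem_filter.1 hb).2) hbk
  · simp

theorem map_succAbove_self {n : ℕ} (j : Fin (n + 2)) (t : stdSimplex ℝ (Fin (n + 1))) :
    map j.succAbove t j = 0 := by
  rw [map_coe, FunOnFinite.linearMap_apply_apply, Finset.sum_eq_zero]
  intro b hb
  exact absurd (Finset.mem_filter.1 hb).2 (Fin.succAbove_ne j b)

theorem map_succAbove_injective {n : ℕ} (j : Fin (n + 2)) :
    Function.Injective (map (S := ℝ) j.succAbove) := by
  intro s t h
  ext k
  rw [← map_succAbove_apply j s k, h, map_succAbove_apply]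

theorem exists_eq_map_succAbove {n : ℕ} (j : Fin (n + 2)) (t : stdSimplex ℝ (Fin (n + 2)))
    (h : t j = 0) : ∃ r, t = map j.succAbove r := by
  refine ⟨⟨fun k => t (j.succAbove k), fun k => zero_le t _, ?_⟩, ?_⟩
  · have := sum_eq_one t
    rwa [Fin.sum_univ_succAbove _ j, h, zero_add] at this
  · ext k
    rcases Fin.eq_self_or_eq_succAbove j k with rfl | ⟨k, rfl⟩
    · rw [map_succAbove_self, h]
    · rw [map_succAbove_apply]
      rfl

/-- A point on two different facets has two vanishing coordinates, so it comes from their common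
codimension-two face. -/
theorem exists_of_map_succAbove_eq {n : ℕ} {i j : Fin (n + 2)} (hij : i ≤ j)
    {s t : stdSimplex ℝ (Fin (n + 2))}
    (h : map i.castSucc.succAbove t = map j.succ.succAbove s) :
    ∃ r, t = map j.succAbove r ∧ s = map i.succAbove r := by
  have ht : t j = 0 := by
    rw [← map_succAbove_apply i.castSucc t j, h,
      Fin.succAbove_of_le_castSucc _ _ (by simpa using hij), map_succAbove_self]
  have hs : s i = 0 := by
    rw [← map_succAbove_apply j.succ s i, ← h,
      Fin.succAbove_of_castSucc_lt _ _ (Fin.castSucc_lt_succ_iff.2 hij), map_succAbove_self]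
  obtain ⟨r, rfl⟩ := exists_eq_map_succAbove j t ht
  obtain ⟨r', rfl⟩ := exists_eq_map_succAbove i s hs
  refine ⟨r, rfl, ?_⟩
  have e : j.succ.succAbove ∘ i.succAbove = i.castSucc.succAbove ∘ j.succAbove := by
    funext k
    have := congrArg (fun f => f.toOrderHom k) (SimplexCategory.δ_comp_δ hij)
    simpa [SimplexCategory.δ] using this
  rw [map_comp_apply, map_comp_apply, e, ← map_comp_apply, ← map_comp_apply] at h
  rw [map_succAbove_injective _ (map_succAbove_injective _ h)]

end stdSimplex

/-! ### Realizations of maps and closed embeddings -/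

namespace DeltaComplex

/-- A map of Δ-complexes that preserves dimensions and faces. -/
structure Hom (K L : DeltaComplex) where
  toFun : ∀ {n : ℕ}, K.Simplex n → L.Simplex n
  map_face : ∀ {n : ℕ} (i : Fin (n + 2)) (σ : K.Simplex (n + 1)),
    toFun (K.face i σ) = L.face i (toFun σ)

theorem point_face (K : DeltaComplex) {n : ℕ} (i : Fin (n + 2)) (σ : K.Simplex (n + 1))
    (t : stdSimplex ℝ (Fin (n + 1))) :
    K.point (K.face i σ) t = K.point σ (stdSimplex.map i.succAbove t) :=
  Quot.sound (Glue.face i σ t)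

theorem exists_point (K : DeltaComplex) (p : K.Realization) :
    ∃ (n : ℕ) (σ : K.Simplex n) (t : stdSimplex ℝ (Fin (n + 1))), p = K.point σ t := by
  obtain ⟨⟨⟨n, σ⟩, t⟩, rfl⟩ := Quot.exists_rep p
  exact ⟨n, σ, t, rfl⟩

theorem continuous_point (K : DeltaComplex) {n : ℕ} (σ : K.Simplex n) :
    Continuous (K.point σ) :=
  continuous_quot_mk.comp
    (continuous_sigmaMk (σ := fun p : Σ n : ℕ, K.Simplex n => stdSimplex ℝ (Fin (p.1 + 1)))
      (i := ⟨n, σ⟩))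

theorem isClosed_iff (K : DeltaComplex) {s : Set K.Realization} :
    IsClosed s ↔ ∀ (n : ℕ) (σ : K.Simplex n), IsClosed (K.point σ ⁻¹' s) := by
  refine ⟨fun h n σ => h.preimage (K.continuous_point σ), fun h => ?_⟩
  have hq : Topology.IsQuotientMap (Quot.mk K.Glue) := isQuotientMap_quot_mk
  refine hq.isClosed_preimage.1 (isClosed_sigma_iff.2 ?_)
  rintro ⟨n, σ⟩
  exact h n σ

namespace Hom

variable {K K' L : DeltaComplex} (f : K.Hom L)

/-- The map of realizations induced by a map of Δ-complexes. -/
def realization : C(K.Realization, L.Realization) where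
  toFun := Quot.lift (fun c => L.point (f.toFun c.1.2) c.2) (by
    rintro _ _ ⟨i, σ, t⟩
    simp only
    rw [f.map_face, point_face])
  continuous_toFun := by
    refine continuous_quot_lift _ (continuous_sigma ?_)
    rintro ⟨n, σ⟩
    exact L.continuous_point (f.toFun σ)

/-- A point of a simplex of `L` lies on a face that is the image of a simplex of `K`, at a place
that belongs to `C`. -/
def Meets (C : Set K.Realization) : ∀ n : ℕ, L.Simplex n → stdSimplex ℝ (Fin (n + 1)) → Prop
  | 0, σ, t => ∃ τ : K.Simplex 0, f.toFun τ = σ ∧ K.point τ t ∈ C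
  | n + 1, σ, t => (∃ τ : K.Simplex (n + 1), f.toFun τ = σ ∧ K.point τ t ∈ C) ∨
      ∃ j s, t = stdSimplex.map j.succAbove s ∧ Meets C n (L.face j σ) s

theorem meets_of_mem {C : Set K.Realization} : ∀ {n : ℕ} {τ : K.Simplex n}
    {t : stdSimplex ℝ (Fin (n + 1))}, K.point τ t ∈ C → f.Meets C n (f.toFun τ) t
  | 0, τ, _, h => ⟨τ, rfl, h⟩
  | _ + 1, τ, _, h => Or.inl ⟨τ, rfl, h⟩

/-- Together with the second alternative in `Meets`, this gives invariance under gluing. If the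
alternative uses another facet j ≠ i, the point lies on the codimension-two face common to both, and
the simplicial identity lets the induction hypothesis apply there. -/
theorem meets_face {C : Set K.Realization} : ∀ {n : ℕ} {σ : L.Simplex (n + 1)} {i : Fin (n + 2)}
    {t : stdSimplex ℝ (Fin (n + 1))}, f.Meets C (n + 1) σ (stdSimplex.map i.succAbove t) →
    f.Meets C n (L.face i σ) t := by
  intro n
  induction n with
  | zero =>
    rintro σ i t (⟨τ, rfl, h⟩ | ⟨j, s, h, hs⟩)
    · rw [← f.map_face]
      exact f.meets_of_mem (by rwa [point_face])
    · rcases Fin.eq_self_or_eq_succAbove j i with rfl | ⟨k, rfl⟩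
      · rwa [stdSimplex.map_succAbove_injective _ h]
      -- The two facets of an edge are distinct vertices, so this case is impossible.
      · have h1 := congrArg (fun v => v (j.succAbove k)) h
        simp only [stdSimplex.map_succAbove_self, stdSimplex.map_succAbove_apply] at h1
        rw [Subsingleton.elim k 0] at h1
        have h2 := stdSimplex.sum_eq_one s
        rw [Fin.sum_univ_one, ← h1] at h2
        exact absurd h2 zero_ne_one
  | succ n ih =>
    rintro σ i t (⟨τ, rfl, h⟩ | ⟨j, s, h, hs⟩)
    · rw [← f.map_face]
      exact f.meets_of_mem (by rwa [point_face])
    · rcases lt_trichotomy i j with hij | rfl | hij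
      · obtain ⟨j, rfl⟩ := Fin.exists_succ_eq.2 (Fin.ne_zero_of_lt hij)
        obtain ⟨i, rfl⟩ := Fin.exists_castSucc_eq.2 (Fin.ne_last_of_lt hij)
        have hij' : i ≤ j := Fin.castSucc_lt_succ_iff.1 hij
        obtain ⟨r, rfl, rfl⟩ := stdSimplex.exists_of_map_succAbove_eq hij' h
        refine Or.inr ⟨j, r, rfl, ?_⟩
        rw [← L.face_face i j hij']
        exact ih hs
      · rwa [stdSimplex.map_succAbove_injective _ h]
      · obtain ⟨i, rfl⟩ := Fin.exists_succ_eq.2 (Fin.ne_zero_of_lt hij)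
        obtain ⟨j, rfl⟩ := Fin.exists_castSucc_eq.2 (Fin.ne_last_of_lt hij)
        have hij' : j ≤ i := Fin.castSucc_lt_succ_iff.1 hij
        obtain ⟨r, rfl, rfl⟩ := stdSimplex.exists_of_map_succAbove_eq hij' h.symm
        refine Or.inr ⟨j, r, rfl, ?_⟩
        rw [L.face_face j i hij']
        exact ih hs

/-- The predicate `Meets` descends to the quotient, so it may be checked on any representative; the
generated equivalence relation never has to be described. -/
theorem meets_of_point_mem {C : Set K.Realization} {n : ℕ} {σ : L.Simplex n}
    {t : stdSimplex ℝ (Fin (n + 1))} (h : L.point σ t ∈ f.realization '' C) :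
    f.Meets C n σ t := by
  let D : L.Realization → Prop := Quot.lift (fun c => f.Meets C c.1.1 c.1.2 c.2) (by
    rintro _ _ ⟨i, σ, t⟩
    exact propext ⟨fun h => Or.inr ⟨i, t, rfl, h⟩, f.meets_face⟩)
  obtain ⟨c, hc, e⟩ := h
  obtain ⟨m, τ, u, rfl⟩ := K.exists_point c
  have h1 : D (L.point (f.toFun τ) u) := f.meets_of_mem hc
  have h2 : D (L.point σ t) := by rwa [← e]
  exact h2

/-- Faces of an image simplex are images of faces, so the chain of faces behind `Meets` lifts to
`K'`. -/
theorem exists_of_meets (g : K'.Hom L) {C : Set K.Realization} : ∀ {n : ℕ} {ρ : K'.Simplex n}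
    {t : stdSimplex ℝ (Fin (n + 1))}, f.Meets C n (g.toFun ρ) t →
    ∃ (m : ℕ) (τ : K.Simplex m) (ρ' : K'.Simplex m) (u : stdSimplex ℝ (Fin (m + 1))),
      f.toFun τ = g.toFun ρ' ∧ K.point τ u ∈ C ∧ K'.point ρ' u = K'.point ρ t := by
  intro n
  induction n with
  | zero =>
    rintro ρ t ⟨τ, h, hC⟩
    exact ⟨0, τ, ρ, t, h, hC, rfl⟩
  | succ n ih =>
    rintro ρ t (⟨τ, h, hC⟩ | ⟨j, s, rfl, h⟩)
    · exact ⟨n + 1, τ, ρ, t, h, hC, rfl⟩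
    · rw [← g.map_face] at h
      obtain ⟨m, τ, ρ', u, h1, h2, h3⟩ := ih h
      exact ⟨m, τ, ρ', u, h1, h2, h3.trans (K'.point_face j ρ s)⟩

/-- A common point of the images of two maps lies on a common simplex of the images. -/
theorem exists_of_realization_eq (g : K'.Hom L) {c : K.Realization} {c' : K'.Realization}
    (h : f.realization c = g.realization c') :
    ∃ (m : ℕ) (τ : K.Simplex m) (ρ : K'.Simplex m) (u : stdSimplex ℝ (Fin (m + 1))),
      f.toFun τ = g.toFun ρ ∧ c = K.point τ u ∧ c' = K'.point ρ u := by
  obtain ⟨n, σ, t, rfl⟩ := K'.exists_point c'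
  have h1 : L.point (g.toFun σ) t ∈ f.realization '' {c} := ⟨c, rfl, h⟩
  obtain ⟨m, τ, ρ, u, h2, h3, h4⟩ := f.exists_of_meets g (f.meets_of_point_mem h1)
  exact ⟨m, τ, ρ, u, h2, (Set.mem_singleton_iff.1 h3).symm, h4.symm⟩

variable {f}

theorem realization_injective (hf : ∀ n : ℕ, Function.Injective (f.toFun (n := n))) :
    Function.Injective f.realization := by
  intro c c' h
  obtain ⟨m, τ, ρ, u, h1, rfl, rfl⟩ := f.exists_of_realization_eq f h
  rw [hf m h1]

/-- Injectivity leaves at most one τ, which avoids an infinite union of closed sets. -/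
theorem isClosed_meets_base (hf : ∀ n : ℕ, Function.Injective (f.toFun (n := n)))
    {C : Set K.Realization} (hC : IsClosed C) {n : ℕ} (σ : L.Simplex n) :
    IsClosed {t | ∃ τ : K.Simplex n, f.toFun τ = σ ∧ K.point τ t ∈ C} := by
  by_cases h : ∃ τ : K.Simplex n, f.toFun τ = σ
  · obtain ⟨τ, rfl⟩ := h
    convert hC.preimage (K.continuous_point τ) using 1
    ext t
    constructor
    · rintro ⟨τ', h1, h2⟩
      rwa [hf n h1] at h2
    · intro h; exact ⟨τ, rfl, h⟩
  · convert isClosed_empty using 1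
    ext t
    simp only [Set.mem_ofPred_eq, Set.mem_empty_iff_false, iff_false]
    rintro ⟨τ, h1, -⟩
    exact h ⟨τ, h1⟩

theorem isClosed_meets (hf : ∀ n : ℕ, Function.Injective (f.toFun (n := n)))
    {C : Set K.Realization} (hC : IsClosed C) : ∀ {n : ℕ} (σ : L.Simplex n),
    IsClosed {t | f.Meets C n σ t} := by
  intro n
  induction n with
  | zero => exact fun σ => isClosed_meets_base hf hC σ
  | succ n ih =>
    intro σ
    have e : {t | f.Meets C (n + 1) σ t} =
        {t | ∃ τ : K.Simplex (n + 1), f.toFun τ = σ ∧ K.point τ t ∈ C} ∪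
          ⋃ j : Fin (n + 2), stdSimplex.map j.succAbove '' {s | f.Meets C n (L.face j σ) s} := by
      ext t
      simp only [Meets, Set.mem_union, Set.mem_iUnion, Set.mem_image, Set.mem_ofPred_eq]
      refine or_congr_right (exists_congr fun j => exists_congr fun s => ?_)
      rw [and_comm, eq_comm]
    rw [e]
    refine (isClosed_meets_base hf hC σ).union (isClosed_iUnion_of_finite fun j => ?_)
    exact ((ih (L.face j σ)).isCompact.image (stdSimplex.continuous_map _)).isClosed

/-- Closedness of an image is tested on each closed simplex. There the preimage is described by
`Meets`, which is closed because a simplex has finitely many facets and they are compact. -/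
theorem isClosedEmbedding_realization (hf : ∀ n : ℕ, Function.Injective (f.toFun (n := n))) :
    Topology.IsClosedEmbedding f.realization := by
  refine .of_continuous_injective_isClosedMap f.realization.continuous
    (realization_injective hf) fun C hC => ?_
  rw [isClosed_iff]
  intro n σ
  convert isClosed_meets hf hC σ using 1
  ext t
  refine ⟨fun h => f.meets_of_point_mem h, fun h => ?_⟩
  clear hf hC
  have key : ∀ (n : ℕ) (σ : L.Simplex n) (t : stdSimplex ℝ (Fin (n + 1))),
      f.Meets C n σ t → L.point σ t ∈ f.realization '' C := by
    intro n
    induction n with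
    | zero => rintro σ t ⟨τ, rfl, h⟩; exact ⟨_, h, rfl⟩
    | succ n ih =>
      rintro σ t (⟨τ, rfl, h⟩ | ⟨j, s, rfl, h⟩)
      · exact ⟨_, h, rfl⟩
      · rw [← point_face]
        exact ih _ _ h
  exact key n σ t h

end Hom

end DeltaComplex

/-! ### Deformation retractions of subspaces -/

/-- The subspace `A` of `Z` can be deformed inside `Z` into `B`, keeping `B` fixed. -/
def DeformsInto {Z : Type*} [TopologicalSpace Z] (A B : Set Z) : Prop :=
  ∃ r : C(A, Z), (∀ a, r a ∈ B) ∧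
    (⟨Subtype.val, continuous_subtype_val⟩ : C(A, Z)).HomotopicRel r {a | (a : Z) ∈ B}

namespace DeformsInto

variable {X Z : Type*} [TopologicalSpace X] [TopologicalSpace Z]

theorem of_subset {A B : Set Z} (h : A ⊆ B) : DeformsInto A B :=
  ⟨⟨Subtype.val, continuous_subtype_val⟩, fun a => h a.2, .refl _⟩

theorem trans {A B C : Set Z} (h : DeformsInto A B) (h' : DeformsInto B C) (hCB : C ⊆ B) :
    DeformsInto A C := by
  obtain ⟨r, hr, ⟨F⟩⟩ := h
  obtain ⟨r', hr', ⟨F'⟩⟩ := h'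
  let q : C(A, B) := ⟨fun a => ⟨r a, hr a⟩, by fun_prop⟩
  refine ⟨r'.comp q, fun a => hr' _, ?_⟩
  have h1 : (⟨Subtype.val, continuous_subtype_val⟩ : C(A, Z)).HomotopicRel r {a | (a : Z) ∈ C} :=
    ⟨{ toHomotopy := F.toHomotopy, prop' := fun t x hx => F.prop' t x (hCB hx) }⟩
  -- The second homotopy starts at the end of the first and fixes C, since the first has not moved
  -- the points of C.
  refine h1.trans ⟨{ toHomotopy := F'.toHomotopy.compContinuousMap q, prop' := ?_ }⟩
  intro t x hx
  have h2 : (x : Z) = r x := h1.fst_eq_snd hx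
  exact F'.prop' t (q x) (show r x ∈ C by rw [← h2]; exact hx)

/-- The constant homotopy on A and the transported one on the image of f agree where both are
defined, because the points over A lie in Y, which stays fixed. Both pieces are closed, so they
paste continuously. -/
theorem union_range {A : Set Z} (hA : IsClosed A) {f : X → Z} (hf : Topology.IsClosedEmbedding f)
    {Y : Set X} (h : DeformationRetractsOnto X Y) (hY : f '' Y ⊆ A)
    (hinter : ∀ x, f x ∈ A → x ∈ Y) : DeformsInto (A ∪ Set.range f) A := by
  classical
  obtain ⟨r, hr, ⟨F⟩⟩ := h
  let e := hf.isEmbedding.toHomeomorph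
  have he : ∀ x h, e.symm ⟨f x, h⟩ = x := fun x h => e.symm_apply_apply x
  let H : unitInterval × Z → Z := fun p =>
    if hp : p.2 ∈ Set.range f then f (F (p.1, e.symm ⟨p.2, hp⟩)) else p.2
  have H_apply : ∀ s x, H (s, f x) = f (F (s, x)) := by
    intro s x
    simp only [H]
    rw [dif_pos ⟨x, rfl⟩, he]
  have H_A : ∀ s, ∀ z ∈ A, H (s, z) = z := by
    intro s z hz
    by_cases hp : z ∈ Set.range f
    · obtain ⟨x, rfl⟩ := hp
      rw [H_apply, F.eq_fst s (hinter x hz)]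
      rfl
    · simp only [H]
      rw [dif_neg hp]
  have c1 : ContinuousOn H (Set.univ ×ˢ A) := by
    refine (continuousOn_snd).congr ?_
    rintro ⟨s, z⟩ hz
    exact H_A s z hz.2
  have c2 : ContinuousOn H (Set.univ ×ˢ Set.range f) := by
    rw [continuousOn_iff_continuous_domRestrict]
    have : (Set.univ ×ˢ Set.range f).domRestrict H =
        fun p => f (F (p.1.1, e.symm ⟨p.1.2, p.2.2⟩)) := by
      funext p
      exact dif_pos p.2.2
    rw [this]
    have := hf.continuous
    fun_prop
  have c3 : ContinuousOn H (Set.univ ×ˢ (A ∪ Set.range f)) := by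
    rw [Set.prod_union]
    exact c1.union_of_isClosed c2 (isClosed_univ.prod hA) (isClosed_univ.prod hf.isClosed_range)
  let G : C(unitInterval × (A ∪ Set.range f : Set Z), Z) :=
    ⟨fun p => H (p.1, p.2), c3.comp_continuous (by fun_prop) fun p => ⟨trivial, p.2.2⟩⟩
  refine ⟨⟨fun a => G (1, a), by fun_prop⟩, ?_, ⟨{
    toContinuousMap := G
    map_zero_left := ?_
    map_one_left := fun _ => rfl
    prop' := ?_ }⟩⟩
  · rintro ⟨z, hz | ⟨x, rfl⟩⟩
    · change H (1, z) ∈ A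
      rwa [H_A 1 z hz]
    · change H (1, f x) ∈ A
      rw [H_apply, F.apply_one]
      exact hY ⟨_, hr x, rfl⟩
  · rintro ⟨z, hz | ⟨x, rfl⟩⟩
    · exact H_A 0 z hz
    · change H (0, f x) = f x
      rw [H_apply, F.apply_zero]
      rfl
  · rintro t ⟨z, hz'⟩ hz
    exact H_A t z hz

theorem deformationRetractsOnto {B : Set Z} (h : DeformsInto Set.univ B) :
    DeformationRetractsOnto Z B := by
  obtain ⟨r, hr, ⟨F⟩⟩ := h
  let q : C(Z, (Set.univ : Set Z)) := ⟨fun z => ⟨z, trivial⟩, by fun_prop⟩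
  exact ⟨r.comp q, fun z => hr _, ⟨{
    toHomotopy := F.toHomotopy.compContinuousMap q
    prop' := fun t x hx => F.prop' t (q x) hx }⟩⟩

end DeformsInto

/-! ### The filtration of `K_W` by the subcomplexes `K_{W_T}` -/

namespace CoxeterSystem

variable {n : ℕ} {M : CoxeterMatrix (Fin n)} {W : Type*} [Group W] (cs : CoxeterSystem M W)

/-- The inclusion of `K_{W_T}` into `K_W`. -/
def inclusionK (T : Finset (Fin n)) : (cs.K T).Hom (cs.K Finset.univ) where
  toFun σ := ⟨σ.1, IsSimplexOfK.mono cs (Finset.subset_univ T) σ.2⟩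
  map_face _ _ := rfl

theorem isClosedEmbedding_inclusionK (T : Finset (Fin n)) :
    Topology.IsClosedEmbedding (cs.inclusionK T).realization :=
  DeltaComplex.Hom.isClosedEmbedding_realization fun _ _ _ h =>
    Subtype.ext (congrArg (fun τ : (cs.K Finset.univ).Simplex _ => τ.1) h)

/-- The union in `K_W` of the realizations of the `K_{W_T}` for `T` in a family. -/
def unionSpace (C : Set (Finset (Fin n))) : Set (cs.K Finset.univ).Realization :=
  ⋃ T ∈ C, Set.range (cs.inclusionK T).realization

theorem isClosed_unionSpace (C : Set (Finset (Fin n))) : IsClosed (cs.unionSpace C) :=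
  C.toFinite.isClosed_biUnion fun T _ => (cs.isClosedEmbedding_inclusionK T).isClosed_range

theorem space_X'_univ :
    (cs.X' Finset.univ).space = cs.unionSpace {T | Finite (cs.parabolic T)} := by
  ext p
  simp only [unionSpace, Set.mem_iUnion, Set.mem_range]
  constructor
  · rintro ⟨m, σ, t, ⟨U, -, hU, hσ⟩, rfl⟩
    exact ⟨U, hU, (cs.K U).point ⟨σ.1, hσ⟩ t, rfl⟩
  · rintro ⟨U, hU, c, rfl⟩
    obtain ⟨m, σ, t, rfl⟩ := (cs.K U).exists_point c
    exact ⟨m, (cs.inclusionK U).toFun σ, t, ⟨U, Finset.subset_univ U, hU, σ.2⟩, rfl⟩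

theorem inclusionK_mem_of_mem_X'' {T : Finset (Fin n)} {C : Set (Finset (Fin n))}
    (hC : ∀ U, U ⊂ T → U ∈ C) {c : (cs.K T).Realization} (hc : c ∈ (cs.X'' T).space) :
    (cs.inclusionK T).realization c ∈ cs.unionSpace C := by
  obtain ⟨m, σ, t, ⟨U, hUT, hne, hσ⟩, rfl⟩ := hc
  simp only [unionSpace, Set.mem_iUnion, Set.mem_range]
  exact ⟨U, hC U (hUT.ssubset_of_ne hne), (cs.K U).point ⟨σ.1, hσ⟩ t, rfl⟩

/-- A common point of K_{W_T} and K_{W_U} lies on a simplex of both, hence on one of K_{W_{T∩U}},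
and T ∩ U ≠ T. -/
theorem mem_X''_of_inclusionK_mem {T : Finset (Fin n)} {C : Set (Finset (Fin n))}
    (hC : ∀ U ∈ C, ¬ T ⊆ U) {c : (cs.K T).Realization}
    (hc : (cs.inclusionK T).realization c ∈ cs.unionSpace C) : c ∈ (cs.X'' T).space := by
  simp only [unionSpace, Set.mem_iUnion, Set.mem_range] at hc
  obtain ⟨U, hU, c', h⟩ := hc
  obtain ⟨m, τ, ρ, u, h1, rfl, rfl⟩ := (cs.inclusionK T).exists_of_realization_eq
    (cs.inclusionK U) h.symm
  refine ⟨m, τ, u, ⟨T ∩ U, Finset.inter_subset_left, ?_, ?_⟩, rfl⟩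
  · intro h2
    exact hC U hU (Finset.inter_eq_left.1 h2)
  · have h3 : τ.1 = ρ.1 := congrArg Subtype.val h1
    refine IsSimplexOfK.inter cs τ.2 ?_
    rw [h3]
    exact ρ.2

theorem deformsInto_insert {T : Finset (Fin n)} {C : Set (Finset (Fin n))}
    (h : (cs.K T).RetractsTo (cs.X'' T)) (h1 : ∀ U, U ⊂ T → U ∈ C) (h2 : ∀ U ∈ C, ¬ T ⊆ U) :
    DeformsInto (cs.unionSpace (insert T C)) (cs.unionSpace C) := by
  have e : cs.unionSpace (insert T C) =
      cs.unionSpace C ∪ Set.range (cs.inclusionK T).realization := by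
    rw [unionSpace, Set.biUnion_insert, Set.union_comm]
    rfl
  rw [e]
  refine DeformsInto.union_range (cs.isClosed_unionSpace C) (cs.isClosedEmbedding_inclusionK T) h
    ?_ fun c => cs.mem_X''_of_inclusionK_mem h2
  rintro _ ⟨c, hc, rfl⟩
  exact cs.inclusionK_mem_of_mem_X'' h1 hc

/-- The family F is closed under passing to subsets with infinite parabolic subgroup. Its member T
of largest cardinality has no superset in the rest, which therefore keeps this closure property;
K_{W_T} is collapsed first and the induction hypothesis does the remainder. -/
theorem deformsInto_finite
    (h : ∀ T : Finset (Fin n), Infinite (cs.parabolic T) → (cs.K T).RetractsTo (cs.X'' T))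
    (F : Finset (Finset (Fin n))) :
    (∀ T ∈ F, Infinite (cs.parabolic T)) →
    (∀ T ∈ F, ∀ U ⊆ T, Infinite (cs.parabolic U) → U ∈ F) →
    DeformsInto (cs.unionSpace ({T | Finite (cs.parabolic T)} ∪ F))
      (cs.unionSpace {T | Finite (cs.parabolic T)}) := by
  induction F using Finset.induction_on_max_value Finset.card with
  | x_1 => exact inferInstance
  | empty =>
    intro _ _
    exact DeformsInto.of_subset (by simp)
  | insert T F hT hmax ih =>
    intro hinf hdown
    have hTinf := hinf T (Finset.mem_insert_self T F)
    have hF : ∀ U ∈ F, ¬ T ⊆ U := by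
      intro U hU hTU
      have := Finset.eq_of_subset_of_card_le hTU (hmax U hU)
      exact hT (this ▸ hU)
    have h1 := ih (fun U hU => hinf U (Finset.mem_insert_of_mem hU)) (by
      intro U hU V hVU hV
      rcases Finset.mem_insert.1 (hdown U (Finset.mem_insert_of_mem hU) V hVU hV) with rfl | hVF
      · exact absurd hVU (hF U hU)
      · exact hVF)
    have h2 : DeformsInto (cs.unionSpace (insert T ({T | Finite (cs.parabolic T)} ∪ F)))
        (cs.unionSpace ({T | Finite (cs.parabolic T)} ∪ F)) := by
      refine cs.deformsInto_insert (h T hTinf) ?_ ?_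
      · intro U hU
        rcases finite_or_infinite (cs.parabolic U) with hfin | hUinf
        · exact Or.inl hfin
        · right
          rcases Finset.mem_insert.1
            (hdown T (Finset.mem_insert_self T F) U hU.subset hUinf) with rfl | hUF
          · exact absurd hU (ssubset_irrefl U)
          · exact hUF
      · rintro U (hU | hU) hTU
        -- A superset of T cannot have a finite parabolic subgroup, since W_T embeds in it.
        · have : Finite (cs.parabolic U) := hU
          exact hTinf.not_finite
            (Finite.of_injective _ (Subgroup.inclusion_injective (cs.parabolic_mono hTU)))
        · exact hF U hU hTU
    rw [Finset.coe_insert, Set.union_insert]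
    exact h2.trans h1 (Set.biUnion_subset_biUnion_left Set.subset_union_left)

end CoxeterSystem

theorem mainTheorem11 {n : ℕ} {M : CoxeterMatrix (Fin n)} {W : Type*} [Group W]
    (cs : CoxeterSystem M W) (hW : Infinite W) (hirr : M.IsIrreducible)
    (h : ∀ T : Finset (Fin n), Infinite (cs.parabolic T) → (cs.K T).RetractsTo (cs.X'' T)) :
    (cs.K Finset.univ).RetractsTo (cs.X' Finset.univ) := by
  classical
  -- With every infinite W_T in the family, S itself belongs to it, so the union is all of K_W.
  have h1 := cs.deformsInto_finite h (Finset.univ.filter fun T => Infinite (cs.parabolic T))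
    (by simp) (by simp)
  have h2 : Infinite (cs.parabolic Finset.univ) := by
    rw [cs.parabolic_univ]
    exact Subgroup.topEquiv.toEquiv.infinite_iff.2 hW
  have h3 : cs.unionSpace ({T | Finite (cs.parabolic T)} ∪
      (Finset.univ.filter fun T => Infinite (cs.parabolic T) : Finset (Finset (Fin n)))) =
      Set.univ := by
    rw [Set.eq_univ_iff_forall]
    intro p
    obtain ⟨m, σ, t, rfl⟩ := (cs.K Finset.univ).exists_point p
    simp only [CoxeterSystem.unionSpace, Set.mem_iUnion]
    exact ⟨Finset.univ, Or.inr (by simpa using h2), (cs.K Finset.univ).point σ t, rfl⟩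
  rw [h3, ← cs.space_X'_univ] at h1
  exact h1.deformationRetractsOnto
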